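/- **Setting.** Let $\mathcal X$ be a finite set, $\mathcal E$ a set of non-oriented edges on $\mathcal X$, and $\vec{\mathcal E}$ the set of oriented edges: to $\{i,j\}\in\mathcal E$ correspond $(i,j)$ and $(j,i)$. Let $R$ be a finite set, $d=|R|$. Let $\Delta_R$ be the set of probability measures on $R$, contained in the hyperplane $T_1=\{v\in\mathbb R^R:\sum_r v(r)=1\}$ of the Euclidean space $\mathbb R^R$. Let $\mathcal M$ be the set of Markov matrices on $\vec{\mathcal E}$. A Markov matrix is *indecomposable* if there is a nonempty set of states each of which can be reached, through transitions of positive probability, from every state; it then has a unique invariant probability measure. On a probability space with a filtration $(\mathcal F_n)_{n\ge 0}$ let $((X_n,P_n,V_n))_{n\ge 0}$ be an adapted process with values in $\mathcal X\times\mathcal M\times\Delta_R$ such that for all $n\ge 1$, $E_n:=(X_{n-1},X_n)\in\vec{\mathcal E}$ and $\mathbb P(E_{n+1}=e\mid\mathcal F_n)=P_n(E_n,e)$ for all $e\in\vec{\mathcal E}$. Set $v_n=\frac1{n+d}\bigl(1+\sum_{k=1}^nV_k\bigr)\in\Delta_R$, and let $L=\{\lim_k v_{n_k}: n_k\to\infty\}$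 be the (random) set of limit points of $(v_n)$. **Hypotheses.** 1. There are a transition matrix $V$ from $\vec{\mathcal E}$ to $R$ (every row $V(e)$ is in $\Delta_R$), a compact convex set $\Sigma\subset\Delta_R$, with interior $\mathring\Sigma$ relative to $T_1$, and a continuous map $P:\Sigma\to\mathcal M$ such that for all $n\ge1$, almost surely, $V_n=V(E_n)$, $v_n\in\mathring\Sigma$ and $P_n=P(v_n)$. 2. $P$ is Lipschitz on $\Sigma$, and $P(v)$ is indecomposable for all $v\in\mathring\Sigma$. For $v\in\mathring\Sigma$ let $\pi(v)$ be the invariant probability measure of $P(v)$, $\pi^V(v)=\pi(v)V\in\Delta_R$, $\Pi(v)$ the matrix all of whose rows are $\pi(v)$, and $Q(v)$ the pseudo-inverse of $I-P(v)$, i.e. the unique matrix with $Q(v)\mathbf 1=0$ and $Q(v)(I-P(v))=(I-P(v))Q(v)=I-\Pi(v)$. 3. $\pi^V$ extends to a Lipschitz map on $\Sigma$ (still denoted $\pi^V$), and for every $e\in\vec{\mathcal E}$ the map $v\mapsto Q(v)V(e)$ extends continuously from $\mathring\Sigma$ to $\Sigma$. Let $F(v)=-v+\pi^V(v)$ for $v\in\Sigma$,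 and let $\Lambda=\{v\in\Sigma: v=\pi^V(v)\}$ be the set of equilibria. A map $H$, differentiable on $\Sigma$, is a *strict Lyapunov function* if $\langle\nabla H(v),F(v)\rangle>0$ for all $v\in\Sigma\setminus\Lambda$. **Theorem.** Assume Hypotheses 1, 2 and 3 and let $H$ be a strict Lyapunov function. (a) If $H(\Lambda)$ has empty interior in $\mathbb R$, then almost surely $L$ is a (nonempty) connected subset of $\Lambda$ and the restriction of $H$ to $L$ is constant. (b) If $\Lambda$ is finite, then almost surely $v_\infty:=\lim_{n\to\infty}v_n$ exists and $v_\infty\in\Lambda$. -/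

import Mathlib

open MeasureTheory Filter Topology

namespace RRW

/-! ### Transition matrices, invariant probability measures, pseudo-inverses -/

/-- A transition matrix from `A` to `B`: every row is a probability measure on `B`. -/
def IsTransition {A B : Type*} [Fintype B] (T : Matrix A B ℝ) : Prop :=
  ∀ a, T a ∈ stdSimplex ℝ B

/-- A Markov matrix `P` on `A` is indecomposable if there is a nonempty set of states, each of which
can be reached from every state of `A` along transitions of positive probability. -/
def Indecomposable {A : Type*} (P : Matrix A A ℝ) : Prop :=
  ∃ C : Set A, C.Nonempty ∧ ∀ i, ∀ j ∈ C, Relation.TransGen (fun a b => 0 < P a b) i j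

/-- `p` is a probability measure on `A` with `p P = p`. -/
def IsInvariantProb {A : Type*} [Fintype A] (P : Matrix A A ℝ) (p : A → ℝ) : Prop :=
  p ∈ stdSimplex ℝ A ∧ Matrix.vecMul p P = p

/-- The invariant probability measure of `P` (it exists and is unique when `P` is an indecomposable
Markov matrix, the only case in which it is used). -/
noncomputable def invProb {A : Type*} [Fintype A] (P : Matrix A A ℝ) : A → ℝ :=
  Classical.epsilon (IsInvariantProb P)

/-- `Q` is the pseudo-inverse of `I - P`: `Q 1 = 0` and `Q (I - P) = (I - P) Q = I - Π`, where every
row of `Π` is the invariant probability measure of `P`. -/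
def IsPseudoInverse {A : Type*} [Fintype A] [DecidableEq A] (P Q : Matrix A A ℝ) : Prop :=
  Matrix.mulVec Q (fun _ => 1) = 0 ∧
    Q * (1 - P) = 1 - Matrix.of (fun _ j => invProb P j) ∧
    (1 - P) * Q = 1 - Matrix.of (fun _ j => invProb P j)

/-- The pseudo-inverse of `I - P` (it exists and is unique when `P` is an indecomposable Markov
matrix, the only case in which it is used). -/
noncomputable def pseudoInverse {A : Type*} [Fintype A] [DecidableEq A] (P : Matrix A A ℝ) :
    Matrix A A ℝ :=
  Classical.epsilon (IsPseudoInverse P)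

/-! ### Oriented edges of a finite non-oriented graph -/

/-- The oriented edges `(i, j)` of the non-oriented graph with edge set `ℰ` (loops are allowed). -/
def OrientedEdge {𝒳 : Type*} (ℰ : Set (Sym2 𝒳)) : Type _ :=
  {p : 𝒳 × 𝒳 // s(p.1, p.2) ∈ ℰ}

instance {𝒳 : Type*} [Finite 𝒳] (ℰ : Set (Sym2 𝒳)) : Finite (OrientedEdge ℰ) :=
  inferInstanceAs (Finite {p : 𝒳 × 𝒳 // s(p.1, p.2) ∈ ℰ})

noncomputable instance {𝒳 : Type*} [Finite 𝒳] (ℰ : Set (Sym2 𝒳)) : Fintype (OrientedEdge ℰ) :=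
  Fintype.ofFinite _

noncomputable instance {𝒳 : Type*} (ℰ : Set (Sym2 𝒳)) : DecidableEq (OrientedEdge ℰ) :=
  Classical.decEq _

/-! ### The walks -/

/-- A process `((X n, P n, V n))` with values in `𝒳 × 𝓜 × Δ_R`, adapted to the filtration `ℱ`, such
that `E n = (X (n - 1), X n)` is an oriented edge for `n ≥ 1` and the conditional law of `E (n + 1)`
given `ℱ n` is `P n (E n)` for `n ≥ 1`. -/
structure ReinforcedWalk {𝒳 : Type*} [Finite 𝒳] (ℰ : Set (Sym2 𝒳)) (R : Type*) [Fintype R]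
    {Ω : Type*} {mΩ : MeasurableSpace Ω} (ℙ : Measure Ω) (ℱ : Filtration ℕ mΩ) where
  /-- the position -/
  X : ℕ → Ω → 𝒳
  /-- the transition matrix in force -/
  P : ℕ → Ω → Matrix (OrientedEdge ℰ) (OrientedEdge ℰ) ℝ
  /-- the reinforcement -/
  V : ℕ → Ω → EuclideanSpace ℝ R
  P_markov : ∀ n ω, IsTransition (P n ω)
  V_prob : ∀ n ω, (V n ω).ofLp ∈ stdSimplex ℝ R
  X_adapted : ∀ n x, MeasurableSet[ℱ n] {ω | X n ω = x}
  P_adapted : ∀ n e e', Measurable[ℱ n] (fun ω => P n ω e e')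
  V_adapted : ∀ n r, Measurable[ℱ n] (fun ω => V n ω r)
  /-- the oriented edge traversed at time `n`; the value `E 0` plays no role -/
  E : ℕ → Ω → OrientedEdge ℰ
  E_eq : ∀ n, 1 ≤ n → ∀ ω, (E n ω).1 = (X (n - 1) ω, X n ω)
  condLaw : ∀ n, 1 ≤ n → ∀ e : OrientedEdge ℰ,
    ℙ[Set.indicator {ω | E (n + 1) ω = e} (fun _ => (1 : ℝ)) | ℱ n] =ᵐ[ℙ]
      fun ω => P n ω (E n ω) e

/-- The reinforcement probability measure `v n = (1 + ∑_{k=1}^n V k) / (n + d)`, `d = |R|`. -/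
noncomputable def ReinforcedWalk.v {𝒳 : Type*} [Finite 𝒳] {ℰ : Set (Sym2 𝒳)} {R : Type*} [Fintype R]
    {Ω : Type*} {mΩ : MeasurableSpace Ω} {ℙ : Measure Ω} {ℱ : Filtration ℕ mΩ}
    (W : ReinforcedWalk ℰ R ℙ ℱ) (n : ℕ) (ω : Ω) : EuclideanSpace ℝ R :=
  WithLp.toLp 2 fun r =>
    (1 + ∑ k ∈ Finset.Icc 1 n, W.V k ω r) / ((n : ℝ) + (Fintype.card R : ℝ))

/-- The limit set of the sequence `(v n)`: all limits of `v (φ k)` for some `φ k → ∞`. -/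
def ReinforcedWalk.limitSet {𝒳 : Type*} [Finite 𝒳] {ℰ : Set (Sym2 𝒳)} {R : Type*} [Fintype R]
    {Ω : Type*} {mΩ : MeasurableSpace Ω} {ℙ : Measure Ω} {ℱ : Filtration ℕ mΩ}
    (W : ReinforcedWalk ℰ R ℙ ℱ) (ω : Ω) : Set (EuclideanSpace ℝ R) :=
  {x | ∃ φ : ℕ → ℕ, Tendsto φ atTop atTop ∧ Tendsto (fun k => W.v (φ k) ω) atTop (𝓝 x)}

/-! ### The hypotheses -/

/-- The hyperplane `T_1 Δ_R` of signed measures on `R` of total mass one. -/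
def massOne (R : Type*) [Fintype R] : Set (EuclideanSpace ℝ R) :=
  {v | ∑ r, v r = 1}

/-- The interior of a set of probability measures on `R`, taken in the hyperplane `T_1 Δ_R`. -/
def massInterior {R : Type*} [Fintype R] (S : Set (EuclideanSpace ℝ R)) :
    Set (EuclideanSpace ℝ R) :=
  {v | v ∈ massOne R ∧ S ∈ 𝓝[massOne R] v}

/-- First set of hypotheses. -/
structure Hyp1 {𝒳 : Type*} [Finite 𝒳] {ℰ : Set (Sym2 𝒳)} {R : Type*} [Fintype R]
    {Ω : Type*} {mΩ : MeasurableSpace Ω} {ℙ : Measure Ω} {ℱ : Filtration ℕ mΩ}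
    (W : ReinforcedWalk ℰ R ℙ ℱ) (V : Matrix (OrientedEdge ℰ) R ℝ) (S : Set (EuclideanSpace ℝ R))
    (P : EuclideanSpace ℝ R → Matrix (OrientedEdge ℰ) (OrientedEdge ℰ) ℝ) : Prop where
  V_transition : IsTransition V
  subset_simplex : ∀ v ∈ S, v.ofLp ∈ stdSimplex ℝ R
  compact : IsCompact S
  convex : Convex ℝ S
  P_markov : ∀ v ∈ S, IsTransition (P v)
  P_continuous : ContinuousOn P S
  V_eq : ∀ n, 1 ≤ n → ∀ᵐ ω ∂ℙ, (W.V n ω).ofLp = V (W.E n ω)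
  v_mem : ∀ n, 1 ≤ n → ∀ᵐ ω ∂ℙ, W.v n ω ∈ massInterior S
  P_eq : ∀ n, 1 ≤ n → ∀ᵐ ω ∂ℙ, W.P n ω = P (W.v n ω)

/-- Second set of hypotheses: `P` is Lipschitz on `S`, and `P v` is indecomposable for `v` in the
interior of `S`. -/
structure Hyp2 {A R : Type*} [Fintype R] (S : Set (EuclideanSpace ℝ R))
    (P : EuclideanSpace ℝ R → Matrix A A ℝ) : Prop where
  lipschitz : ∃ K : ℝ, ∀ v ∈ S, ∀ w ∈ S, ∀ e e', |P v e e' - P w e e'| ≤ K * dist v w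
  indecomposable : ∀ v ∈ massInterior S, Indecomposable (P v)

/-- Third set of hypotheses: `piV` is a Lipschitz extension to `S` of the map `v ↦ π(v) V` defined
on the interior of `S`, where `π(v)` is the invariant probability measure of `P v`; and for every
`e` the map `v ↦ Q(v) V (e)`, with `Q(v)` the pseudo-inverse of `I - P v`, extends continuously from
the interior of `S` to `S`. -/
structure Hyp3 {A R : Type*} [Fintype A] [DecidableEq A] [Fintype R] (V : Matrix A R ℝ)
    (S : Set (EuclideanSpace ℝ R)) (P : EuclideanSpace ℝ R → Matrix A A ℝ)
    (piV : EuclideanSpace ℝ R → EuclideanSpace ℝ R) : Prop where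
  piV_eq : ∀ v ∈ massInterior S, (piV v).ofLp = Matrix.vecMul (invProb (P v)) V
  piV_lipschitz : ∃ K : NNReal, LipschitzOnWith K piV S
  QV_extends : ∀ e : A, ∃ q : EuclideanSpace ℝ R → (R → ℝ), ContinuousOn q S ∧
    ∀ v ∈ massInterior S, q v = (pseudoInverse (P v) * V) e

/-! ### Equilibria and strict Lyapunov functions -/

/-- The vector field `F v = -v + π^V v` on `S`. -/
noncomputable def field {R : Type*} (piV : EuclideanSpace ℝ R → EuclideanSpace ℝ R)
    (v : EuclideanSpace ℝ R) : EuclideanSpace ℝ R :=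
  -v + piV v

/-- The set `Λ` of equilibria in `S`. -/
def equilibria {R : Type*} (S : Set (EuclideanSpace ℝ R))
    (piV : EuclideanSpace ℝ R → EuclideanSpace ℝ R) : Set (EuclideanSpace ℝ R) :=
  {v | v ∈ S ∧ v = piV v}

/-- `H` is differentiable on `S`, and `⟨∇H(v), F(v)⟩ > 0` at every `v ∈ S` that is not an
equilibrium. -/
def IsStrictLyapunov {R : Type*} [Fintype R] (S : Set (EuclideanSpace ℝ R))
    (piV : EuclideanSpace ℝ R → EuclideanSpace ℝ R) (H : EuclideanSpace ℝ R → ℝ) : Prop :=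
  ∀ v ∈ S, ∃ g : EuclideanSpace ℝ R, HasGradientWithinAt H g S v ∧
    (v ∉ equilibria S piV → 0 < inner ℝ g (field piV v))

end RRW

/-! The sequence moves by `v (n + 1) - v n = γ n (F (v n) + w n)` with `γ n` of order `1 / n`: a
noisy Euler scheme for the field `F`, along which `H` increases strictly away from the zeros of `F`,
that is, away from the equilibria.

Probability enters only in showing that the noise `V (E (n + 1)) - π^V (v n)` averages out. The
edges form a controlled Markov chain rather than independent draws, so the Poisson equation `V - π V
= (I - P) Q V` (`sub_vecMul_invProb`) is used to split the noise into a martingale increment, a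
telescoping difference and a remainder that tends to zero. The first has an almost surely convergent
weighted sum, because `∑ γ n ^ 2 < ∞`; the second is handled by Abel summation. This gives
`ae_approxScheme`.

The rest is pathwise. Near a point `p` with `F p ≠ 0`, short windows of the scheme raise `H`
linearly in elapsed time up to an arbitrarily small error (`exists_ascent`). If `H (v n)`
oscillated, it would descend infinitely often from some level `b` outside `H(Λ)`; a cluster point of
the starting points has `H = b`, hence is no equilibrium, and the ascent there forbids the descent.
So `H (v n)` converges, and the same ascent excludes cluster points outside `Λ`. Connectedness of
the limit set needs only compactness and vanishing increments. -/

namespace RRW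

/-! ### Negligible noise -/

/-- Along any window of bounded length in the time scale `∑ γ j`, the accumulated noise `∑ γ j • w j`
tends to zero as the window moves to infinity. -/
def NegligibleNoise {E : Type*} [NormedAddCommGroup E] [NormedSpace ℝ E] (γ : ℕ → ℝ) (w : ℕ → E) :
    Prop :=
  ∀ ε > 0, ∀ᶠ m in atTop, ∀ n ≥ m,
    ‖∑ j ∈ Finset.Ico m n, γ j • w j‖ ≤ ε * (1 + ∑ j ∈ Finset.Ico m n, γ j)

section Noise

variable {E : Type*} [NormedAddCommGroup E] [NormedSpace ℝ E] {γ : ℕ → ℝ}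

theorem NegligibleNoise.add {w w' : ℕ → E} (h : NegligibleNoise γ w) (h' : NegligibleNoise γ w') :
    NegligibleNoise γ (fun j => w j + w' j) := by
  intro ε hε
  filter_upwards [h (ε / 2) (by positivity), h' (ε / 2) (by positivity)] with m hm hm' n hn
  simp only [smul_add, Finset.sum_add_distrib]
  refine (norm_add_le _ _).trans ?_
  linarith [hm n hn, hm' n hn]

theorem NegligibleNoise.congr {w w' : ℕ → E} (h : NegligibleNoise γ w)
    (hw : ∀ᶠ j in atTop, w j = w' j) : NegligibleNoise γ w' := by
  intro ε hε
  obtain ⟨N, hN⟩ := eventually_atTop.1 hw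
  filter_upwards [h ε hε, eventually_ge_atTop N] with m hm hmN n hn
  have : ∑ j ∈ Finset.Ico m n, γ j • w' j = ∑ j ∈ Finset.Ico m n, γ j • w j :=
    Finset.sum_congr rfl fun j hj => by rw [hN j (hmN.trans (Finset.mem_Ico.1 hj).1)]
  rw [this]
  exact hm n hn

theorem negligibleNoise_zero (hγ : ∀ n, 0 ≤ γ n) : NegligibleNoise γ (fun _ => (0 : E)) := by
  intro ε hε
  refine Eventually.of_forall fun m n _ => ?_
  have := Finset.sum_nonneg fun j (_ : j ∈ Finset.Ico m n) => hγ j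
  simp only [smul_zero, Finset.sum_const_zero, norm_zero]
  positivity

theorem NegligibleNoise.sum {ι : Type*} (hγ : ∀ n, 0 ≤ γ n) (s : Finset ι) {w : ι → ℕ → E}
    (h : ∀ i ∈ s, NegligibleNoise γ (w i)) : NegligibleNoise γ (fun j => ∑ i ∈ s, w i j) := by
  classical
  induction s using Finset.induction_on with
  | empty => simpa using negligibleNoise_zero hγ
  | insert i s hi ih =>
    simp only [Finset.sum_insert hi]
    exact (h i (by simp)).add (ih fun k hk => h k (by simp [hk]))

theorem NegligibleNoise.smul_const {w : ℕ → ℝ} (hγ : ∀ n, 0 ≤ γ n) (h : NegligibleNoise γ w)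
    (x : E) : NegligibleNoise γ (fun j => w j • x) := by
  intro ε hε
  filter_upwards [h (ε / (‖x‖ + 1)) (by positivity)] with m hm n hn
  have h1 : ∑ j ∈ Finset.Ico m n, γ j • w j • x = (∑ j ∈ Finset.Ico m n, γ j • w j) • x := by
    rw [Finset.sum_smul]
    exact Finset.sum_congr rfl fun j _ => by simp [smul_smul]
  have h2 := Finset.sum_nonneg fun j (_ : j ∈ Finset.Ico m n) => hγ j
  rw [h1, norm_smul]
  calc _ ≤ ε / (‖x‖ + 1) * (1 + ∑ j ∈ Finset.Ico m n, γ j) * (‖x‖ + 1) := by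
        gcongr
        · exact hm n hn
        · linarith
    _ = _ := by field_simp

theorem negligibleNoise_of_tendsto_zero {w : ℕ → E} (hγ : ∀ n, 0 ≤ γ n)
    (hw : Tendsto w atTop (𝓝 0)) : NegligibleNoise γ w := by
  intro ε hε
  obtain ⟨N, hN⟩ := eventually_atTop.1 ((tendsto_zero_iff_norm_tendsto_zero.1 hw).eventually
    (ge_mem_nhds hε))
  filter_upwards [eventually_ge_atTop N] with m hm n hn
  calc _ ≤ ∑ j ∈ Finset.Ico m n, ‖γ j • w j‖ := norm_sum_le _ _
    _ ≤ ∑ j ∈ Finset.Ico m n, ε * γ j := by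
        refine Finset.sum_le_sum fun j hj => ?_
        rw [norm_smul, Real.norm_of_nonneg (hγ j), mul_comm]
        exact mul_le_mul_of_nonneg_right (hN j (hm.trans (Finset.mem_Ico.1 hj).1)) (hγ j)
    _ ≤ _ := by rw [← Finset.mul_sum]; linarith

/-- Window sums are differences of partial sums, so the Cauchy criterion applies. This covers the
martingale part of the noise. -/
theorem negligibleNoise_of_tendsto_sum {w : ℕ → E} {l : E} (hγ : ∀ n, 0 ≤ γ n)
    (hw : Tendsto (fun n => ∑ j ∈ Finset.range n, γ j • w j) atTop (𝓝 l)) :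
    NegligibleNoise γ w := by
  intro ε hε
  obtain ⟨N, hN⟩ := Metric.cauchySeq_iff.1 hw.cauchySeq ε hε
  filter_upwards [eventually_ge_atTop N] with m hm n hn
  have h1 := hN n (hm.trans hn) m hm
  have h2 := Finset.sum_nonneg fun j (_ : j ∈ Finset.Ico m n) => hγ j
  rw [dist_eq_norm, ← Finset.sum_Ico_eq_sub _ hn] at h1
  nlinarith

/-- By Abel summation the differences pass from `a` to the monotone weights, whose total variation
over a window starting at `m` is at most `γ m`. -/
theorem negligibleNoise_telescoping {a : ℕ → ℝ} {C : ℝ} (hγ : ∀ n, 0 ≤ γ n) (hanti : Antitone γ)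
    (hγ0 : Tendsto γ atTop (𝓝 0)) (ha : ∀ n, |a n| ≤ C) :
    NegligibleNoise γ (fun j => a j - a (j + 1)) := by
  intro ε hε
  have hC : 0 ≤ C := (abs_nonneg _).trans (ha 0)
  -- With the boundary term added, the sum equals `γ m * a m - ∑ (γ j - γ (j + 1)) * a (j + 1)`,
  -- bounded by `C γ m + C (γ m - γ n)`.
  have key : ∀ m n, m ≤ n → |∑ j ∈ Finset.Ico m n, γ j * (a j - a (j + 1)) + γ n * a n| ≤
      C * (2 * γ m - γ n) := by
    intro m n hmn
    induction n, hmn using Nat.le_induction with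
    | base =>
      simp only [Finset.Ico_self, Finset.sum_empty, zero_add, abs_mul, abs_of_nonneg (hγ m)]
      nlinarith [ha m, hγ m]
    | succ n hmn ih =>
      have h1 := hanti (Nat.le_succ n)
      have h2 : |(γ n - γ (n + 1)) * a (n + 1)| ≤ C * (γ n - γ (n + 1)) := by
        rw [abs_mul, abs_of_nonneg (sub_nonneg.2 h1), mul_comm]
        exact mul_le_mul_of_nonneg_right (ha _) (sub_nonneg.2 h1)
      have h3 := (abs_sub _ _).trans (add_le_add ih h2)
      rw [Finset.sum_Ico_succ_top hmn]
      calc _ = |∑ j ∈ Finset.Ico m n, γ j * (a j - a (j + 1)) + γ n * a n -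
            (γ n - γ (n + 1)) * a (n + 1)| := by congr 1; ring
        _ ≤ _ := h3
        _ = _ := by ring
  have hlim : Tendsto (fun m => 2 * C * γ m) atTop (𝓝 0) := by simpa using hγ0.const_mul (2 * C)
  filter_upwards [hlim.eventually (ge_mem_nhds hε)] with m hm n hn
  have h1 := key m n hn
  have h2 : |γ n * a n| ≤ C * γ n := by
    rw [abs_mul, abs_of_nonneg (hγ n), mul_comm]
    exact mul_le_mul_of_nonneg_right (ha _) (hγ n)
  have h3 := Finset.sum_nonneg fun j (_ : j ∈ Finset.Ico m n) => hγ j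
  simp only [smul_eq_mul, Real.norm_eq_abs]
  rw [abs_le] at *
  constructor <;> nlinarith

end Noise

/-! ### Stochastic approximation schemes with a Lyapunov function -/

/-- A sequence in `S` with steps `γ n • (F (v n) + w n)`, where `γ n → 0`, `∑ γ n = ∞` and the noise
`w` is negligible. -/
structure ApproxScheme {E : Type*} [NormedAddCommGroup E] [NormedSpace ℝ E] (S : Set E)
    (F : E → E) (γ : ℕ → ℝ) (v w : ℕ → E) : Prop where
  mem : ∀ n, v n ∈ S
  step_nonneg : ∀ n, 0 ≤ γ n
  step_tendsto : Tendsto γ atTop (𝓝 0)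
  step_sum : Tendsto (fun n => ∑ j ∈ Finset.range n, γ j) atTop atTop
  succ_eq : ∀ n, v (n + 1) - v n = γ n • (F (v n) + w n)
  bounded : ∃ B, ∀ n, ‖F (v n) + w n‖ ≤ B
  noise : NegligibleNoise γ w

namespace ApproxScheme

section Normed

variable {E : Type*} [NormedAddCommGroup E] [NormedSpace ℝ E] {S : Set E} {F : E → E} {γ : ℕ → ℝ}
  {v w : ℕ → E}

theorem tendsto_succ_sub (h : ApproxScheme S F γ v w) :
    Tendsto (fun n => v (n + 1) - v n) atTop (𝓝 0) := by
  obtain ⟨B, hB⟩ := h.bounded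
  have hlim : Tendsto (fun n => γ n * B) atTop (𝓝 0) := by simpa using h.step_tendsto.mul_const B
  refine squeeze_zero_norm (fun n => ?_) hlim
  rw [h.succ_eq, norm_smul, Real.norm_of_nonneg (h.step_nonneg n)]
  exact mul_le_mul_of_nonneg_left (hB n) (h.step_nonneg n)

theorem sum_succ_sub (h : ApproxScheme S F γ v w) {m n : ℕ} (hmn : m ≤ n) :
    v n - v m = ∑ j ∈ Finset.Ico m n, γ j • (F (v j) + w j) := by
  rw [← Finset.sum_Ico_sub v hmn]
  exact Finset.sum_congr rfl fun j _ => h.succ_eq j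

theorem sum_step_mono (h : ApproxScheme S F γ v w) {m n n' : ℕ} (hn : n ≤ n') :
    ∑ j ∈ Finset.Ico m n, γ j ≤ ∑ j ∈ Finset.Ico m n', γ j :=
  Finset.sum_le_sum_of_subset_of_nonneg (Finset.Ico_subset_Ico_right hn)
    fun j _ _ => h.step_nonneg j

theorem norm_sub_le (h : ApproxScheme S F γ v w) {B : ℝ} (hB : ∀ n, ‖F (v n) + w n‖ ≤ B)
    {m n : ℕ} (hmn : m ≤ n) : ‖v n - v m‖ ≤ B * ∑ j ∈ Finset.Ico m n, γ j := by
  rw [h.sum_succ_sub hmn, Finset.mul_sum]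
  refine (norm_sum_le _ _).trans (Finset.sum_le_sum fun j _ => ?_)
  rw [norm_smul, Real.norm_of_nonneg (h.step_nonneg j), mul_comm]
  exact mul_le_mul_of_nonneg_right (hB j) (h.step_nonneg j)

/-- Windows of prescribed length in the time scale `∑ γ j` exist. -/
theorem exists_window (h : ApproxScheme S F γ v w) {θ : ℝ} (hθ : 0 < θ) :
    ∃ N, ∀ m ≥ N, ∀ u ≥ m, θ < ∑ j ∈ Finset.Ico m u, γ j →
      ∃ n, m < n ∧ n ≤ u ∧ θ / 2 ≤ ∑ j ∈ Finset.Ico m n, γ j ∧ ∑ j ∈ Finset.Ico m n, γ j ≤ θ := by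
  classical
  -- Once single steps are at most `θ / 2`, the first time the elapsed time reaches `θ / 2` cannot
  -- overshoot `θ`.
  obtain ⟨N, hN⟩ := eventually_atTop.1 (h.step_tendsto.eventually (ge_mem_nhds (half_pos hθ)))
  refine ⟨N, fun m hm u hu hlt => ?_⟩
  have hex : ∃ n, θ / 2 ≤ ∑ j ∈ Finset.Ico m n, γ j := ⟨u, by linarith⟩
  have hpos : m < Nat.find hex := by
    by_contra hle
    have := Nat.find_spec hex
    rw [Finset.Ico_eq_empty (by omega), Finset.sum_empty] at this
    linarith
  obtain ⟨k, hk⟩ : ∃ k, Nat.find hex = k + 1 := ⟨Nat.find hex - 1, by omega⟩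
  refine ⟨k + 1, by omega, ?_, hk ▸ Nat.find_spec hex, ?_⟩
  · rw [← hk]
    exact Nat.find_min' hex (by linarith)
  · have h1 := Nat.find_min hex (m := k) (by omega)
    have h2 := hN k (by omega)
    rw [Finset.sum_Ico_succ_top (by omega)]
    linarith

theorem exists_sum_gt (h : ApproxScheme S F γ v w) (m : ℕ) (θ : ℝ) :
    ∃ u ≥ m, θ < ∑ j ∈ Finset.Ico m u, γ j := by
  obtain ⟨u, hu1, hu2⟩ := ((eventually_ge_atTop m).and (h.step_sum.eventually_gt_atTop
    (θ + ∑ j ∈ Finset.range m, γ j))).exists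
  exact ⟨u, hu1, by rw [Finset.sum_Ico_eq_sub _ hu1]; linarith⟩

/-- Over short windows started close to `p`, the sequence moves in the direction `F p`. -/
theorem exists_norm_sub_le (h : ApproxScheme S F γ v w) {p : E} (hp : p ∈ S)
    (hF : ContinuousOn F S) {κ ρ : ℝ} (hκ : 0 < κ) (hρ : 0 < ρ) :
    ∃ θ > 0, ∀ ε > 0, ∃ δ > 0, ∃ N, ∀ m ≥ N, ‖v m - p‖ < δ → ∀ n ≥ m,
      ∑ j ∈ Finset.Ico m n, γ j ≤ θ → ‖v n - p‖ ≤ ρ ∧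
        ‖v n - p - (∑ j ∈ Finset.Ico m n, γ j) • F p‖ ≤ κ * (∑ j ∈ Finset.Ico m n, γ j) + ε := by
  obtain ⟨B, hB⟩ := h.bounded
  have hB0 : 0 ≤ B := (norm_nonneg _).trans (hB 0)
  obtain ⟨ρ', hρ', hFρ⟩ := Metric.continuousWithinAt_iff.1 (hF p hp) (κ / 2) (by positivity)
  set r := min ρ (ρ' / 2) with hr
  have hr0 : 0 < r := by positivity
  -- At speed at most `B`, a window of this length displaces the sequence by at most `r / 2`. It is
  -- chosen before `ε`, so that later `ε` can be taken small compared with the gain over a window.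
  refine ⟨r / (2 * (B + 1)), by positivity, fun ε hε => ?_⟩
  have hε' : 0 < min (ε / 2) (κ / 2) := by positivity
  obtain ⟨N, hN⟩ := eventually_atTop.1 (h.noise _ hε')
  refine ⟨min (r / 2) (ε / 2), by positivity, N, fun m hm hmp n hn hT => ?_⟩
  have hclose : ∀ j, m ≤ j → j ≤ n → ‖v j - p‖ ≤ r := by
    intro j hj hjn
    have h1 := h.norm_sub_le hB hj
    have h2 := (h.sum_step_mono (m := m) hjn).trans hT
    have h3 : B * ∑ i ∈ Finset.Ico m j, γ i ≤ r / 2 := by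
      calc _ ≤ (B + 1) * (r / (2 * (B + 1))) := by
            gcongr
            · exact Finset.sum_nonneg fun i _ => h.step_nonneg i
            · linarith
        _ = _ := by field_simp
    have h4 : ‖v j - p‖ ≤ ‖v j - v m‖ + ‖v m - p‖ := by
      simpa using norm_add_le (v j - v m) (v m - p)
    linarith [min_le_left (r / 2) (ε / 2)]
  refine ⟨(hclose n hn le_rfl).trans (min_le_left _ _), ?_⟩
  set T := ∑ j ∈ Finset.Ico m n, γ j with hTdef
  have hT0 : 0 ≤ T := Finset.sum_nonneg fun i _ => h.step_nonneg i
  -- Error budget: `ε / 2` for the starting point, `κ / 2 * T` for the variation of `F`, and `ε / 2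
  -- + κ / 2 * T` for the noise.
  have hdecomp : v n - p - T • F p = (v m - p) +
      (∑ j ∈ Finset.Ico m n, γ j • (F (v j) - F p) + ∑ j ∈ Finset.Ico m n, γ j • w j) := by
    have := h.sum_succ_sub hn
    rw [eq_add_of_sub_eq this, hTdef, Finset.sum_smul]
    simp only [smul_add, smul_sub, Finset.sum_add_distrib, Finset.sum_sub_distrib]
    abel
  have h1 : ‖∑ j ∈ Finset.Ico m n, γ j • (F (v j) - F p)‖ ≤ κ / 2 * T := by
    rw [hTdef, Finset.mul_sum]
    refine (norm_sum_le _ _).trans (Finset.sum_le_sum fun j hj => ?_)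
    rw [norm_smul, Real.norm_of_nonneg (h.step_nonneg j), mul_comm]
    refine mul_le_mul_of_nonneg_right ?_ (h.step_nonneg j)
    have hj' := Finset.mem_Ico.1 hj
    have := hFρ (h.mem j) (by
      rw [dist_eq_norm]
      linarith [hclose j hj'.1 hj'.2.le, min_le_right ρ (ρ' / 2)])
    rw [dist_eq_norm] at this
    exact this.le
  have h2 := hN m hm n hn
  have h3 : min (ε / 2) (κ / 2) * (1 + T) ≤ ε / 2 + κ / 2 * T := by
    nlinarith [min_le_left (ε / 2) (κ / 2), min_le_right (ε / 2) (κ / 2)]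
  rw [hdecomp]
  refine (norm_add_le _ _).trans ?_
  have h4 := norm_add_le (∑ j ∈ Finset.Ico m n, γ j • (F (v j) - F p))
    (∑ j ∈ Finset.Ico m n, γ j • w j)
  linarith [min_le_right (r / 2) (ε / 2)]

end Normed

section Lyapunov

variable {E : Type*} [NormedAddCommGroup E] [InnerProductSpace ℝ E] [CompleteSpace E] {S : Set E}
  {F : E → E} {γ : ℕ → ℝ} {v w : ℕ → E} {H : E → ℝ}

/-- Over short windows started close to a point `p` where `H` increases along `F`, the function `H`
increases linearly, up to an arbitrarily small error. -/
theorem exists_ascent (h : ApproxScheme S F γ v w) {p g : E} (hp : p ∈ S) (hF : ContinuousOn F S)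
    (hg : HasGradientWithinAt H g S p) (hpos : 0 < inner ℝ g (F p)) :
    ∃ θ > 0, ∃ c > 0, ∀ ε > 0, ∃ δ > 0, ∃ N, ∀ m ≥ N, ‖v m - p‖ < δ → ∀ n ≥ m,
      ∑ j ∈ Finset.Ico m n, γ j ≤ θ → H p + c * ∑ j ∈ Finset.Ico m n, γ j - ε ≤ H (v n) := by
  set a := inner ℝ g (F p) with ha
  -- The ideal gain is `T * a`. The Taylor remainder along `T • F p` costs at most `a / 4 * T`, and
  -- the deviation `z` from that displacement at most `a / 4 * T + ε`, which leaves the slope `a /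
  -- 2`.
  obtain ⟨η, hη, hηa⟩ : ∃ η > 0, η * ‖F p‖ ≤ a / 4 :=
    ⟨a / (4 * (‖F p‖ + 1)), by positivity, by
      rw [div_mul_eq_mul_div, div_le_div_iff₀ (by positivity) (by positivity)]
      nlinarith [norm_nonneg (F p)]⟩
  set κ := a / (4 * (‖g‖ + η)) with hκ
  have hgη : 0 < ‖g‖ + η := by positivity
  have hκa : (‖g‖ + η) * κ = a / 4 := by rw [hκ]; field_simp
  have hlo := (hasGradientWithinAt_iff_isLittleO.1 hg).def hη
  obtain ⟨ρ, hρ, hρH⟩ := Metric.mem_nhdsWithin_iff.1 hlo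
  obtain ⟨θ, hθ, hwin⟩ := h.exists_norm_sub_le hp hF (κ := κ) (ρ := ρ / 2) (by positivity)
    (by positivity)
  refine ⟨θ, hθ, a / 2, by positivity, fun ε hε => ?_⟩
  obtain ⟨δ, hδ, N, hN⟩ := hwin (ε / (‖g‖ + η)) (by positivity)
  refine ⟨δ, hδ, N, fun m hm hmp n hn hT => ?_⟩
  obtain ⟨h1, h2⟩ := hN m hm hmp n hn hT
  set T := ∑ j ∈ Finset.Ico m n, γ j with hTdef
  have hT0 : 0 ≤ T := Finset.sum_nonneg fun i _ => h.step_nonneg i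
  have h3 : |H (v n) - H p - inner ℝ g (v n - p)| ≤ η * ‖v n - p‖ := by
    have := hρH (show v n ∈ Metric.ball p ρ ∩ S from
      ⟨by rw [Metric.mem_ball, dist_eq_norm]; linarith, h.mem n⟩)
    simpa using this
  set z := v n - p - T • F p with hz
  have hvz : v n - p = T • F p + z := by rw [hz]; abel
  have h4 : inner ℝ g (v n - p) = T * a + inner ℝ g z := by
    rw [hvz, inner_add_right, inner_smul_right]
  have h5 : |inner ℝ g z| ≤ ‖g‖ * ‖z‖ := abs_real_inner_le_norm g z
  have h6 : ‖v n - p‖ ≤ T * ‖F p‖ + ‖z‖ := by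
    rw [hvz]
    refine (norm_add_le _ _).trans ?_
    rw [norm_smul, Real.norm_of_nonneg hT0]
  have h7 : (‖g‖ + η) * ‖z‖ ≤ a / 4 * T + ε := by
    calc _ ≤ (‖g‖ + η) * (κ * T + ε / (‖g‖ + η)) := by gcongr
      _ = (‖g‖ + η) * κ * T + ε := by field_simp
      _ = _ := by rw [hκa]
  have h8 : η * ‖v n - p‖ ≤ a / 4 * T + η * ‖z‖ := by nlinarith
  rw [abs_le] at h3 h5
  nlinarith

end Lyapunov

end ApproxScheme

/-! ### Cluster points of slowly varying sequences -/

/-- Discrete substitute for the intermediate value theorem; when increments vanish, the last time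
above the level sits asymptotically at the level. -/
theorem exists_last_ge {h : ℕ → ℝ} {b : ℝ} {s u : ℕ} (hsu : s ≤ u) (hs : b ≤ h s) (hu : h u < b) :
    ∃ t, s ≤ t ∧ t < u ∧ b ≤ h t ∧ ∀ j, t < j → j ≤ u → h j < b := by
  induction u, hsu using Nat.le_induction with
  | base => exact absurd hs (not_le.2 hu)
  | succ n hn ih =>
    by_cases hb : b ≤ h n
    · exact ⟨n, hn, n.lt_succ_self, hb, fun j hj hj' => by
        obtain rfl : j = n + 1 := by omega
        exact hu⟩
    · obtain ⟨t, h1, h2, h3, h4⟩ := ih (not_le.1 hb)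
      refine ⟨t, h1, h2.trans n.lt_succ_self, h3, fun j hj hj' => ?_⟩
      rcases Nat.lt_or_ge n j with hnj | hnj
      · obtain rfl : j = n + 1 := by omega
        exact hu
      · exact h4 j hj hnj

/-- The set of cluster points of a sequence in a compact set whose increments tend to zero is
connected. -/
theorem isConnected_clusterPts {E : Type*} [NormedAddCommGroup E] {S : Set E} (hS : IsCompact S)
    {v : ℕ → E} (hv : ∀ n, v n ∈ S) (hd : Tendsto (fun n => v (n + 1) - v n) atTop (𝓝 0)) :
    IsConnected {x | MapClusterPt x atTop v} := by
  set L := {x | MapClusterPt x atTop v} with hL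
  have hLc : IsClosed L := isClosed_setOfPred_clusterPt
  have hne : L.Nonempty := by
    obtain ⟨x, _, hx⟩ := hS.exists_mapClusterPt (f := atTop) (u := v)
      (le_principal_iff.2 (mem_map.2 (univ_mem' hv)))
    exact ⟨x, hx⟩
  refine ⟨hne, isPreconnected_iff_subset_of_disjoint_closed.2 fun A B hA hB hAB hd' => ?_⟩
  by_contra hcon
  push Not at hcon
  obtain ⟨⟨x, hxL, hxA⟩, ⟨y, hyL, hyB⟩⟩ := And.imp Set.not_subset.1 Set.not_subset.1 hcon
  have hxB : x ∈ L ∩ B := ⟨hxL, (hAB hxL).resolve_left hxA⟩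
  have hyA : y ∈ L ∩ A := ⟨hyL, (hAB hyL).resolve_right hyB⟩
  have hdisj : ∀ z ∈ L, z ∈ A → z ∈ B → False := fun z h1 h2 h3 => by
    have : z ∈ L ∩ (A ∩ B) := ⟨h1, h2, h3⟩
    simp [hd'] at this
  -- `f` is nonzero on `L`, being negative on `L ∩ A` and positive on `L ∩ B`. Yet `f (v n)` changes
  -- sign infinitely often, and a cluster point of the crossings would be a zero of `f` in `L`.
  let f : E → ℝ := fun z => Metric.infDist z (L ∩ A) - Metric.infDist z (L ∩ B)
  have hf : Continuous f := by fun_prop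
  have hcl : ∀ {A}, IsClosed A → (L ∩ A).Nonempty → ∀ z, z ∉ A → 0 < Metric.infDist z (L ∩ A) :=
    fun hA hne z hz => ((hLc.inter hA).notMem_iff_infDist_pos hne).1 fun h => hz h.2
  have hfx : 0 < f x := by
    have h1 := hcl hA ⟨y, hyA⟩ x hxA
    simpa [f, Metric.infDist_zero_of_mem hxB] using h1
  have hfy : f y < 0 := by
    have h1 := hcl hB ⟨x, hxB⟩ y hyB
    simpa [f, Metric.infDist_zero_of_mem hyA] using h1
  have hfreq : ∀ z ∈ L, ∀ U ∈ 𝓝 (f z), ∃ᶠ n in atTop, f (v n) ∈ U := fun z hz U hU =>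
    hz.frequently (hf.continuousAt.preimage_mem_nhds hU)
  have hcross : ∀ N, ∃ t ≥ N, 0 ≤ f (v t) ∧ f (v (t + 1)) < 0 := fun N => by
    obtain ⟨s, hs1, hs2⟩ := (frequently_atTop.1 (hfreq x hxL _ (Ioi_mem_nhds hfx))) N
    obtain ⟨u, hu1, hu2⟩ := (frequently_atTop.1 (hfreq y hyL _ (Iio_mem_nhds hfy))) s
    obtain ⟨t, h1, h2, h3, h4⟩ := exists_last_ge (h := fun n => f (v n)) hu1 (le_of_lt hs2) hu2
    exact ⟨t, hs1.trans h1, h3, h4 _ t.lt_succ_self h2⟩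
  choose t ht1 ht2 ht3 using hcross
  have htt : Tendsto t atTop atTop := tendsto_atTop_mono ht1 tendsto_id
  obtain ⟨z, -, φ, hφ, hz⟩ := hS.tendsto_subseq fun n => hv (t n)
  have hz' : Tendsto (fun n => v (t (φ n) + 1)) atTop (𝓝 z) := by
    have := hz.add (hd.comp (htt.comp hφ.tendsto_atTop))
    simpa using this
  have hzL : z ∈ L := MapClusterPt.of_comp (htt.comp hφ.tendsto_atTop) hz.mapClusterPt
  have h0 : f z = 0 := le_antisymm
    (le_of_tendsto' ((hf.tendsto z).comp hz') fun n => (ht3 _).le)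
    (ge_of_tendsto' ((hf.tendsto z).comp hz) fun n => ht2 _)
  rcases hAB hzL with hzA | hzB
  · have h1 := hcl hB ⟨x, hxB⟩ z fun h => hdisj z hzL hzA h
    have h2 := Metric.infDist_zero_of_mem (show z ∈ L ∩ A from ⟨hzL, hzA⟩)
    simp only [f] at h0
    linarith
  · have h1 := hcl hA ⟨y, hyA⟩ z fun h => hdisj z hzL h hzB
    have h2 := Metric.infDist_zero_of_mem (show z ∈ L ∩ B from ⟨hzL, hzB⟩)
    simp only [f] at h0
    linarith

/-! ### Convergence of the Lyapunov function and location of the cluster points. -/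

namespace ApproxScheme

variable {E : Type*} [NormedAddCommGroup E] [InnerProductSpace ℝ E] [CompleteSpace E] {S : Set E}
  {F : E → E} {γ : ℕ → ℝ} {v w : ℕ → E} {H : E → ℝ}

omit [CompleteSpace E] in
theorem tendsto_comp_of_mem (h : ApproxScheme S F γ v w) (hH : ContinuousOn H S) {p : E}
    (hp : p ∈ S) {t : ℕ → ℕ} (ht : Tendsto (fun k => v (t k)) atTop (𝓝 p)) :
    Tendsto (fun k => H (v (t k))) atTop (𝓝 (H p)) :=
  (hH p hp).tendsto.comp (tendsto_nhdsWithin_iff.2 ⟨ht, Eventually.of_forall fun _ => h.mem _⟩)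

/-- Along the scheme, a strict Lyapunov function converges if its set of critical values has empty
interior. -/
theorem exists_tendsto_lyapunov (h : ApproxScheme S F γ v w) (hS : IsCompact S)
    (hF : ContinuousOn F S)
    (hH : ∀ p ∈ S, ∃ g, HasGradientWithinAt H g S p ∧ (F p ≠ 0 → 0 < inner ℝ g (F p)))
    (hint : interior (H '' {p ∈ S | F p = 0}) = ∅) :
    ∃ l, Tendsto (fun n => H (v n)) atTop (𝓝 l) := by
  have hHc : ContinuousOn H S := fun p hp => by
    obtain ⟨g, hg, _⟩ := hH p hp
    exact hg.continuousWithinAt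
  obtain ⟨C, hC⟩ := hS.exists_bound_of_continuousOn hHc
  have hCn : ∀ n, |H (v n)| ≤ C := fun n => hC _ (h.mem n)
  -- It is enough to exclude oscillation between levels of a dense set, here the complement of the
  -- critical values.
  refine tendsto_of_no_upcrossings (interior_eq_empty_iff_dense_compl.1 hint) ?_
    (isBoundedUnder_of ⟨C, fun n => (abs_le.1 (hCn n)).2⟩)
    (isBoundedUnder_of ⟨-C, fun n => (abs_le.1 (hCn n)).1⟩)
  rintro a - b hb hab ⟨hfa, hfb⟩
  have hcross : ∀ N, ∃ t ≥ N, ∃ u > t, b ≤ H (v t) ∧ H (v u) < a ∧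
      ∀ j, t < j → j ≤ u → H (v j) < b := fun N => by
    obtain ⟨s, hs1, hs2⟩ := (frequently_atTop.1 hfb) N
    obtain ⟨u, hu1, hu2⟩ := (frequently_atTop.1 hfa) s
    obtain ⟨t, h1, h2, h3, h4⟩ :=
      exists_last_ge (h := fun n => H (v n)) hu1 (le_of_lt hs2) (hu2.trans hab)
    exact ⟨t, hs1.trans h1, u, h2, h3, hu2, h4⟩
  choose t ht1 u hut hbt hua hlt using hcross
  have htt : Tendsto t atTop atTop := tendsto_atTop_mono ht1 tendsto_id
  obtain ⟨p, hpS, φ, hφ, hp⟩ := hS.tendsto_subseq fun n => h.mem (t n)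
  have htφ : Tendsto (fun k => t (φ k)) atTop atTop := htt.comp hφ.tendsto_atTop
  have hp' : Tendsto (fun k => v (t (φ k) + 1)) atTop (𝓝 p) := by
    have := hp.add (h.tendsto_succ_sub.comp htφ)
    simpa using this
  -- `H` is at least `b` at time `t` and below `b` one step later, and both points converge to `p`.
  have hHp : H p = b := le_antisymm
    (le_of_tendsto' (h.tendsto_comp_of_mem hHc hpS hp')
      fun k => (hlt _ _ (Nat.lt_succ_self _) (hut _)).le)
    (ge_of_tendsto' (h.tendsto_comp_of_mem hHc hpS hp) fun k => hbt _)
  have hFp : F p ≠ 0 := fun h0 => hb ⟨p, ⟨hpS, h0⟩, hHp⟩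
  obtain ⟨g, hg, hpos⟩ := hH p hpS
  obtain ⟨θ, hθ, c, hc, hasc⟩ := h.exists_ascent hpS hF hg (hpos hFp)
  -- A descent that fits in one window would end at height at least `a`; a longer one would be back
  -- at height at least `b` after elapsed time `θ / 2`. The two terms of the minimum serve these two
  -- cases.
  obtain ⟨δ, hδ, N, hN⟩ := hasc (min (b - a) (c * (θ / 2))) (lt_min (by linarith) (by positivity))
  obtain ⟨N', hN'⟩ := h.exists_window hθ
  obtain ⟨k, hk1, hk2, hk3⟩ := ((htφ.eventually_ge_atTop N).and ((htφ.eventually_ge_atTop N').and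
    (Metric.tendsto_nhds.1 hp δ hδ))).exists
  rw [dist_eq_norm] at hk3
  set m := t (φ k) with hm
  set n' := u (φ k) with hn'
  have hmn : m < n' := hut _
  have hnn : 0 ≤ ∑ j ∈ Finset.Ico m n', γ j := Finset.sum_nonneg fun j _ => h.step_nonneg j
  rcases le_or_gt (∑ j ∈ Finset.Ico m n', γ j) θ with hT | hT
  · have h1 := hN m hk1 hk3 n' hmn.le hT
    have h2 : H (v n') < a := hua _
    have h3 := min_le_left (b - a) (c * (θ / 2))
    have h4 := mul_nonneg hc.le hnn
    linarith
  · obtain ⟨n, h1, h2, h3, h4⟩ := hN' m hk2 n' hmn.le hT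
    have h5 := hN m hk1 hk3 n h1.le h4
    have h6 : H (v n) < b := hlt _ _ h1 h2
    have h7 := min_le_right (b - a) (c * (θ / 2))
    have h8 := mul_le_mul_of_nonneg_left h3 hc.le
    linarith

/-- If a strict Lyapunov function converges along the scheme, all cluster points are zeros of the
vector field. -/
theorem eq_zero_of_mapClusterPt (h : ApproxScheme S F γ v w) (hS : IsCompact S)
    (hF : ContinuousOn F S)
    (hH : ∀ p ∈ S, ∃ g, HasGradientWithinAt H g S p ∧ (F p ≠ 0 → 0 < inner ℝ g (F p)))
    {l : ℝ} (hl : Tendsto (fun n => H (v n)) atTop (𝓝 l)) {p : E} (hp : MapClusterPt p atTop v) :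
    p ∈ S ∧ H p = l ∧ F p = 0 := by
  have hHc : ContinuousOn H S := fun p hp => by
    obtain ⟨g, hg, _⟩ := hH p hp
    exact hg.continuousWithinAt
  obtain ⟨φ, hφ, hφp⟩ := hp.tendsto_subseq
  have hpS : p ∈ S := hS.isClosed.mem_of_tendsto hφp (Eventually.of_forall fun _ => h.mem _)
  have hHp : H p = l := tendsto_nhds_unique (h.tendsto_comp_of_mem hHc hpS hφp)
    (hl.comp hφ.tendsto_atTop)
  refine ⟨hpS, hHp, ?_⟩
  by_contra hFp
  obtain ⟨g, hg, hpos⟩ := hH p hpS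
  obtain ⟨θ, hθ, c, hc, hasc⟩ := h.exists_ascent hpS hF hg (hpos hFp)
  -- A window of length at least `θ / 2` gains `c * θ / 2`, so `H` would exceed its limit by at
  -- least `c * θ / 4` infinitely often.
  obtain ⟨δ, hδ, N, hN⟩ := hasc (c * θ / 4) (by positivity)
  obtain ⟨N', hN'⟩ := h.exists_window hθ
  obtain ⟨M, hM⟩ := eventually_atTop.1 (hl.eventually (Iio_mem_nhds
    (show l < l + c * θ / 4 by linarith [show 0 < c * θ by positivity])))
  obtain ⟨k, hk1, hk2, hk3, hk4⟩ := ((hφ.tendsto_atTop.eventually_ge_atTop N).and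
    ((hφ.tendsto_atTop.eventually_ge_atTop N').and ((hφ.tendsto_atTop.eventually_ge_atTop M).and
    (Metric.tendsto_nhds.1 hφp δ hδ)))).exists
  rw [dist_eq_norm] at hk4
  obtain ⟨u, hu1, hu2⟩ := h.exists_sum_gt (φ k) θ
  obtain ⟨n, h1, -, h3, h4⟩ := hN' _ hk2 u hu1 hu2
  have h5 := hN _ hk1 hk4 n h1.le h4
  have h6 : H (v n) < l + c * θ / 4 := hM n (hk3.trans h1.le)
  have h8 := mul_le_mul_of_nonneg_left h3 hc.le
  linarith

end ApproxScheme

/-! ### Finite Markov chains -/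

section Markov

open Matrix

theorem IsTransition.mulVec_one {A B : Type*} [Fintype B] {T : Matrix A B ℝ} (hT : IsTransition T) :
    T *ᵥ (fun _ => 1) = fun _ => 1 := by
  funext a
  simpa [mulVec, dotProduct] using (hT a).2

variable {A : Type*} [Fintype A]

/-- A Markov matrix on a finite nonempty set has an invariant probability measure. -/
theorem exists_isInvariantProb [DecidableEq A] [Nonempty A] {P : Matrix A A ℝ}
    (hP : IsTransition P) : ∃ p, IsInvariantProb P p := by
  have hdet : (1 - P).det = 0 := by
    refine exists_mulVec_eq_zero_iff.1 ⟨fun _ => 1, fun h => ?_, ?_⟩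
    · simpa using congrFun h (Classical.arbitrary A)
    · rw [sub_mulVec, one_mulVec, hP.mulVec_one, sub_self]
  obtain ⟨x, hx0, hx⟩ := exists_vecMul_eq_zero_iff.2 hdet
  rw [vecMul_sub, vecMul_one, sub_eq_zero] at hx
  have hxj : ∀ j, x j = ∑ i, x i * P i j := fun j => congrFun hx j
  -- A left fixed vector may change sign, but `|x|` is dominated by `|x| P`, which has the same
  -- total mass; hence the two are equal.
  have hle : ∀ j, |x j| ≤ ∑ i, |x i| * P i j := fun j => by
    conv_lhs => rw [hxj j]
    refine (Finset.abs_sum_le_sum_abs _ _).trans (Finset.sum_le_sum fun i _ => ?_)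
    rw [abs_mul, abs_of_nonneg ((hP i).1 j)]
  have hsum : ∑ j, |x j| = ∑ j, ∑ i, |x i| * P i j := by
    rw [Finset.sum_comm]
    refine Finset.sum_congr rfl fun i _ => ?_
    rw [← Finset.mul_sum, (hP i).2, mul_one]
  have heq := (Finset.sum_eq_sum_iff_of_le fun j _ => hle j).1 hsum
  have hpos : 0 < ∑ j, |x j| := by
    obtain ⟨j, hj⟩ := Function.ne_iff.1 hx0
    exact Finset.sum_pos' (fun _ _ => abs_nonneg _) ⟨j, Finset.mem_univ _, abs_pos.2 hj⟩
  refine ⟨fun j => |x j| / ∑ i, |x i|, ⟨fun j => by positivity, ?_⟩, ?_⟩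
  · rw [← Finset.sum_div, div_self hpos.ne']
  · funext j
    rw [heq j (Finset.mem_univ _), Finset.sum_div]
    simp only [vecMul, dotProduct]
    exact Finset.sum_congr rfl fun i _ => by ring

theorem isInvariantProb_invProb [DecidableEq A] [Nonempty A] {P : Matrix A A ℝ}
    (hP : IsTransition P) : IsInvariantProb P (invProb P) :=
  Classical.epsilon_spec (exists_isInvariantProb hP)

/-- Harmonic functions of an indecomposable Markov matrix are constant. -/
theorem Indecomposable.const_of_mulVec_eq [Nonempty A] {P : Matrix A A ℝ} (hP : IsTransition P)
    (hI : Indecomposable P) {x : A → ℝ} (hx : P *ᵥ x = x) : ∃ c, x = fun _ => c := by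
  obtain ⟨C, ⟨k, hk⟩, hC⟩ := hI
  -- Maximum principle: the maximum propagates along positive transitions, hence reaches `k`.
  -- Applied to `-x` it gives the minimum.
  have hmax : ∀ y : A → ℝ, P *ᵥ y = y → ∀ i, y i ≤ y k := by
    intro y hy i
    obtain ⟨m, hm⟩ := Finite.exists_max y
    have hstep : ∀ a b, 0 < P a b → y a = y m → y b = y m := by
      intro a b hab ha
      have h1 : ∑ j, P a j * (y m - y j) = 0 := by
        have h2 : ∑ j, P a j * y j = y a := congrFun hy a
        simp only [mul_sub, Finset.sum_sub_distrib, ← Finset.sum_mul, (hP a).2, h2]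
        linarith
      have h3 := (Finset.sum_eq_zero_iff_of_nonneg fun j _ =>
        mul_nonneg ((hP a).1 j) (sub_nonneg.2 (hm j))).1 h1 b (Finset.mem_univ _)
      rcases mul_eq_zero.1 h3 with h4 | h4
      · exact absurd h4 hab.ne'
      · linarith
    have : y k = y m := by
      have := hC m k hk
      clear hk
      induction this with
      | single h => exact hstep _ _ h rfl
      | tail _ h ih => exact hstep _ _ h ih
    exact this ▸ hm i
  refine ⟨x k, funext fun i => le_antisymm (hmax x hx i) ?_⟩
  have := hmax (-x) (by rw [mulVec_neg, hx]) i
  simpa using this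

/-- An indecomposable Markov matrix has a pseudo-inverse. -/
theorem isPseudoInverse_pseudoInverse [DecidableEq A] [Nonempty A] {P : Matrix A A ℝ}
    (hP : IsTransition P) (hI : Indecomposable P) : IsPseudoInverse P (pseudoInverse P) := by
  refine Classical.epsilon_spec (p := IsPseudoInverse P) ?_
  obtain ⟨⟨-, hsum⟩, hinv⟩ := isInvariantProb_invProb hP
  unfold IsPseudoInverse
  set p := invProb P with hp
  set J : Matrix A A ℝ := Matrix.of fun _ j => p j with hJ
  have hJP : J * P = J := by
    ext i j
    exact congrFun hinv j
  have hPJ : P * J = J := by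
    ext i j
    simp only [hJ, mul_apply, of_apply, ← Finset.sum_mul, (hP i).2, one_mul]
  have hJJ : J * J = J := by
    ext i j
    simp only [hJ, mul_apply, of_apply, ← Finset.sum_mul, hsum, one_mul]
  have hJ1 : J *ᵥ (fun _ => 1) = fun _ => 1 := by
    funext i
    simpa [hJ, mulVec, dotProduct] using hsum
  set M := 1 - P + J with hM
  have hJM : J * M = J := by rw [hM, mul_add, mul_sub, mul_one, hJP, hJJ, sub_self, zero_add]
  have hMJ : M * J = J := by rw [hM, add_mul, sub_mul, one_mul, hPJ, hJJ, sub_self, zero_add]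
  -- If `M x = 0` then `J x = J M x = 0`, so `P x = x` and `x` is constant; `J` fixes constants, so
  -- `x = 0`. The pseudo-inverse is then `M⁻¹ - J`.
  have hdet : M.det ≠ 0 := by
    intro h0
    obtain ⟨x, hx0, hx⟩ := exists_mulVec_eq_zero_iff.2 h0
    have hJx : J *ᵥ x = 0 := by rw [← hJM, ← mulVec_mulVec, hx, mulVec_zero]
    have hPx : P *ᵥ x = x := by
      rw [hM, add_mulVec, sub_mulVec, one_mulVec, hJx, add_zero, sub_eq_zero] at hx
      exact hx.symm
    obtain ⟨c, rfl⟩ := hI.const_of_mulVec_eq hP hPx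
    have hc : (fun _ : A => c) = c • fun _ => (1 : ℝ) := by
      funext
      simp
    rw [hc, mulVec_smul, hJ1, ← hc] at hJx
    exact hx0 hJx
  have hu : IsUnit M.det := isUnit_iff_ne_zero.2 hdet
  have h1 : M * M⁻¹ = 1 := mul_nonsing_inv M hu
  have h2 : M⁻¹ * M = 1 := nonsing_inv_mul M hu
  have hJi : J * M⁻¹ = J := by
    conv_lhs => rw [← hJM]
    rw [mul_assoc, h1, mul_one]
  have hiJ : M⁻¹ * J = J := by
    conv_lhs => rw [← hMJ]
    rw [← mul_assoc, h2, one_mul]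
  have hsub : 1 - P = M - J := by rw [hM]; abel
  refine ⟨M⁻¹ - J, ?_, ?_, ?_⟩
  · have hM1 : M *ᵥ (fun _ => 1) = fun _ => 1 := by
      rw [hM, add_mulVec, sub_mulVec, one_mulVec, hP.mulVec_one, hJ1, sub_self, zero_add]
    have hi1 : M⁻¹ *ᵥ (fun _ => 1) = fun _ => 1 := by
      conv_lhs => rw [← hM1]
      rw [mulVec_mulVec, h2, one_mulVec]
    rw [sub_mulVec, hi1, hJ1, sub_self]
  · rw [hsub, sub_mul, mul_sub, mul_sub, h2, hiJ, hJM, hJJ]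
    abel
  · rw [hsub, sub_mul, mul_sub, mul_sub, h1, hMJ, hJi, hJJ]
    abel

/-- The Poisson equation: `f - π f = (I - P) Q f`. -/
theorem sub_vecMul_invProb {B : Type*} [DecidableEq A] [Nonempty A] {P : Matrix A A ℝ}
    (hP : IsTransition P) (hI : Indecomposable P) (V : Matrix A B ℝ) (e : A) (r : B) :
    V e r - vecMul (invProb P) V r =
      (pseudoInverse P * V) e r - ∑ e', P e e' * (pseudoInverse P * V) e' r := by
  have h := (isPseudoInverse_pseudoInverse hP hI).2.2
  have h' : (1 - P) * pseudoInverse P * V = (1 - Matrix.of fun _ j => invProb P j) * V := by rw [h]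
  rw [Matrix.sub_mul, Matrix.sub_mul, Matrix.sub_mul, Matrix.one_mul, Matrix.one_mul,
    Matrix.mul_assoc] at h'
  have h'' := congrFun (congrFun h' e) r
  rw [Matrix.sub_apply, Matrix.sub_apply, mul_apply (M := P)] at h''
  exact h''.symm

end Markov

/-! ### Weighted sums of bounded martingale increments -/

/-- If `∑ γ n ^ 2 < ∞` and the `D n` are bounded martingale increments, then `∑ γ n * D n` converges
almost surely. -/
theorem ae_tendsto_sum_martingale_increments {Ω : Type*} {mΩ : MeasurableSpace Ω} {μ : Measure Ω}
    [IsProbabilityMeasure μ] {𝒢 : Filtration ℕ mΩ} {D : ℕ → Ω → ℝ} {γ : ℕ → ℝ} {C : ℝ}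
    (hm : ∀ n, Measurable[𝒢 (n + 1)] (D n)) (hb : ∀ n ω, |D n ω| ≤ C)
    (hc : ∀ n, μ[D n | 𝒢 n] =ᵐ[μ] 0) (hγ : Summable fun n => γ n ^ 2) :
    ∀ᵐ ω ∂μ, ∃ l, Tendsto (fun n => ∑ j ∈ Finset.range n, γ j * D j ω) atTop (𝓝 l) := by
  set M : ℕ → Ω → ℝ := fun n ω => ∑ j ∈ Finset.range n, γ j * D j ω with hM
  have hMsucc : ∀ n ω, M (n + 1) ω = M n ω + γ n * D n ω := fun n ω => Finset.sum_range_succ _ _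
  have hMm : ∀ n, Measurable[𝒢 n] (M n) := fun n =>
    Finset.measurable_fun_sum _ fun j hj =>
      ((hm j).mono (𝒢.mono (Finset.mem_range.1 hj)) le_rfl).const_mul _
  have hMm' : ∀ n, Measurable (M n) := fun n => (hMm n).mono (𝒢.le n) le_rfl
  have hDm' : ∀ n, Measurable (D n) := fun n => (hm n).mono (𝒢.le _) le_rfl
  have hMb : ∀ n ω, |M n ω| ≤ ∑ j ∈ Finset.range n, |γ j| * C := fun n ω =>
    (Finset.abs_sum_le_sum_abs _ _).trans (Finset.sum_le_sum fun j _ => by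
      rw [abs_mul]
      exact mul_le_mul_of_nonneg_left (hb j ω) (abs_nonneg _))
  have hint : ∀ {f : Ω → ℝ} {K : ℝ}, Measurable f → (∀ ω, |f ω| ≤ K) → Integrable f μ :=
    fun hf hK => Integrable.of_bound hf.aestronglyMeasurable _ (Eventually.of_forall hK)
  have hMi : ∀ n, Integrable (M n) μ := fun n => hint (hMm' n) (hMb n)
  have hDi : ∀ n, Integrable (D n) μ := fun n => hint (hDm' n) (hb n)
  have hMDb : ∀ n ω, |(M n * D n) ω| ≤ (∑ j ∈ Finset.range n, |γ j| * C) * C := fun n ω => by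
    rw [Pi.mul_apply, abs_mul]
    exact mul_le_mul (hMb n ω) (hb n ω) (abs_nonneg _) ((abs_nonneg _).trans (hMb n ω))
  have hMDi : ∀ n, Integrable (M n * D n) μ := fun n => hint ((hMm' n).mul (hDm' n)) (hMDb n)
  have hM2i : ∀ n, Integrable (fun ω => M n ω ^ 2) μ := fun n =>
    hint (K := (∑ j ∈ Finset.range n, |γ j| * C) ^ 2) ((hMm' n).pow_const 2) fun ω => by
      rw [abs_pow]
      exact pow_le_pow_left₀ (abs_nonneg _) (hMb n ω) 2
  have hD2i : ∀ n, Integrable (fun ω => D n ω ^ 2) μ := fun n =>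
    hint (K := C ^ 2) ((hDm' n).pow_const 2) fun ω => by
      rw [abs_pow]
      exact pow_le_pow_left₀ (abs_nonneg _) (hb n ω) 2
  have hmart : Martingale M 𝒢 μ := by
    refine martingale_of_condExp_sub_eq_zero_nat (fun n => (hMm n).stronglyMeasurable) hMi
      fun n => ?_
    have h1 : M (n + 1) - M n = γ n • D n := by
      funext ω
      simp [hMsucc]
    rw [h1]
    refine (condExp_smul (γ n) (D n) (𝒢 n)).trans ?_
    filter_upwards [hc n] with ω hω
    simp [hω]
  -- Orthogonality of increments bounds the second moments by `C ^ 2 * ∑ γ j ^ 2`; the `L¹` bound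
  -- needed for martingale convergence follows from `|x| ≤ 1 + x ^ 2`.
  have horth : ∀ n, ∫ ω, M n ω * D n ω ∂μ = 0 := fun n => by
    have h1 := condExp_mul_of_stronglyMeasurable_left (hMm n).stronglyMeasurable (hMDi n) (hDi n)
    have h2 : μ[M n * D n | 𝒢 n] =ᵐ[μ] 0 := by
      filter_upwards [h1, hc n] with ω h1 h2
      simp [h1, h2]
    calc ∫ ω, M n ω * D n ω ∂μ = ∫ ω, (μ[M n * D n | 𝒢 n]) ω ∂μ :=
          (integral_condExp (𝒢.le n)).symm
      _ = 0 := by simpa using integral_congr_ae h2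
  have hsq : ∀ n, ∫ ω, M n ω ^ 2 ∂μ ≤ ∑ j ∈ Finset.range n, γ j ^ 2 * C ^ 2 := by
    intro n
    induction n with
    | zero => simp [hM]
    | succ n ih =>
      have h1 : ∫ ω, M (n + 1) ω ^ 2 ∂μ =
          ∫ ω, M n ω ^ 2 ∂μ + 2 * γ n * ∫ ω, M n ω * D n ω ∂μ + γ n ^ 2 * ∫ ω, D n ω ^ 2 ∂μ := by
        have h2 : Integrable (fun ω => 2 * γ n * (M n ω * D n ω)) μ := (hMDi n).const_mul _
        rw [← integral_const_mul, ← integral_const_mul, ← integral_add (hM2i n) h2,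
          ← integral_add (f := fun ω => M n ω ^ 2 + 2 * γ n * (M n ω * D n ω))
            ((hM2i n).add h2) ((hD2i n).const_mul _)]
        exact integral_congr_ae (Eventually.of_forall fun ω => by
          simp only [hMsucc]
          ring)
      have h2 : ∫ ω, D n ω ^ 2 ∂μ ≤ C ^ 2 := by
        have := integral_mono (hD2i n) (integrable_const (C ^ 2)) fun ω =>
          sq_le_sq' (abs_le.1 (hb n ω)).1 (abs_le.1 (hb n ω)).2
        simpa using this
      rw [h1, horth, Finset.sum_range_succ]
      nlinarith [sq_nonneg (γ n)]
  set K := ∑' j, γ j ^ 2 * C ^ 2 with hK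
  have hsq' : ∀ n, ∫ ω, M n ω ^ 2 ∂μ ≤ K := fun n => (hsq n).trans
    ((hγ.mul_right _).sum_le_tsum _ fun j _ => by positivity)
  refine hmart.submartingale.exists_ae_tendsto_of_bdd (R := (1 + K).toNNReal) fun n => ?_
  rw [eLpNorm_one_eq_lintegral_enorm, ← ofReal_integral_norm_eq_lintegral_enorm (hMi n)]
  refine ENNReal.ofReal_le_ofReal ?_
  calc ∫ ω, ‖M n ω‖ ∂μ ≤ ∫ ω, (1 + M n ω ^ 2) ∂μ :=
        integral_mono (hMi n).norm ((integrable_const _).add (hM2i n)) fun ω => by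
          simp only [Real.norm_eq_abs]
          nlinarith [sq_abs (M n ω), sq_nonneg (|M n ω| - 1)]
    _ = 1 + ∫ ω, M n ω ^ 2 ∂μ := by
        rw [integral_add (integrable_const _) (hM2i n)]
        simp
    _ ≤ 1 + K := by linarith [hsq' n]

/-! ### The walk as an approximation scheme -/

theorem norm_le_one_of_mem_stdSimplex {R : Type*} [Fintype R] {x : EuclideanSpace ℝ R}
    (hx : x.ofLp ∈ stdSimplex ℝ R) : ‖x‖ ≤ 1 := by
  rw [EuclideanSpace.norm_eq, Real.sqrt_le_one]
  calc ∑ r, ‖x r‖ ^ 2 ≤ ∑ r, x r := Finset.sum_le_sum fun r _ => by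
        have h0 := hx.1 r
        have h1 : x r ≤ 1 := by
          rw [← hx.2]
          exact Finset.single_le_sum (fun i _ => hx.1 i) (Finset.mem_univ r)
        rw [Real.norm_of_nonneg h0]
        nlinarith
    _ = 1 := hx.2

theorem NegligibleNoise.of_coord {R : Type*} [Fintype R] {γ : ℕ → ℝ} (hγ : ∀ n, 0 ≤ γ n)
    {w : ℕ → EuclideanSpace ℝ R} (h : ∀ r, NegligibleNoise γ fun n => w n r) :
    NegligibleNoise γ w := by
  classical
  have h1 := NegligibleNoise.sum hγ Finset.univ
    fun r _ => (h r).smul_const hγ (EuclideanSpace.single r (1 : ℝ))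
  refine h1.congr (Eventually.of_forall fun n => ?_)
  ext r
  simp [Pi.single_apply]

/-- The step of the scheme satisfied by `n ↦ v (n + 1)`. -/
noncomputable def walkStep (R : Type*) [Fintype R] (n : ℕ) : ℝ :=
  1 / ((n : ℝ) + (2 + Fintype.card R))

section Step

variable (R : Type*) [Fintype R]

theorem walkStep_nonneg (n : ℕ) : 0 ≤ walkStep R n := by
  unfold walkStep
  positivity

theorem antitone_walkStep : Antitone (walkStep R) := fun m n hmn => by
  unfold walkStep
  gcongr

theorem walkStep_le (n : ℕ) : walkStep R n ≤ 1 / ((n : ℝ) + 1) := by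
  unfold walkStep
  gcongr
  linarith [(Nat.cast_nonneg (Fintype.card R) : (0 : ℝ) ≤ _)]

theorem tendsto_walkStep : Tendsto (walkStep R) atTop (𝓝 0) :=
  squeeze_zero (walkStep_nonneg R) (walkStep_le R) tendsto_one_div_add_atTop_nhds_zero_nat

theorem summable_walkStep_sq : Summable fun n => walkStep R n ^ 2 := by
  have h : Summable fun n : ℕ => 1 / ((n : ℝ) + 1) ^ 2 := by
    have := (summable_nat_add_iff 1).2 (Real.summable_one_div_nat_pow.2 one_lt_two)
    simpa using this
  refine h.of_nonneg_of_le (fun n => sq_nonneg _) fun n => ?_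
  rw [← one_div_pow]
  exact pow_le_pow_left₀ (walkStep_nonneg R n) (walkStep_le R n) 2

theorem tendsto_sum_walkStep :
    Tendsto (fun n => ∑ j ∈ Finset.range n, walkStep R j) atTop atTop := by
  refine (not_summable_iff_tendsto_nat_atTop_of_nonneg (walkStep_nonneg R)).1 fun h => ?_
  have h' : Summable fun n : ℕ => 1 / ((n + (2 + Fintype.card R) : ℕ) : ℝ) := by
    refine h.congr fun n => ?_
    simp [walkStep]
  exact Real.not_summable_one_div_natCast ((summable_nat_add_iff (2 + Fintype.card R)).1 h')

end Step

namespace ReinforcedWalk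

variable {𝒳 : Type*} [Finite 𝒳] {ℰ : Set (Sym2 𝒳)} {R : Type*} [Fintype R] {Ω : Type*}
  {mΩ : MeasurableSpace Ω} {ℙ : Measure Ω} {ℱ : Filtration ℕ mΩ} (W : ReinforcedWalk ℰ R ℙ ℱ)

/-- The sequence is started at time `1`, since the hypotheses on `v n` and the conditional laws hold
only for `n ≥ 1`. -/
theorem v_succ_sub (n : ℕ) (ω : Ω) :
    W.v (n + 2) ω - W.v (n + 1) ω = walkStep R n • (W.V (n + 2) ω - W.v (n + 1) ω) := by
  ext r
  have h1 : (0 : ℝ) < (n : ℝ) + 1 + Fintype.card R := by positivity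
  have h2 : (0 : ℝ) < (n : ℝ) + 2 + Fintype.card R := by positivity
  have h3 : (0 : ℝ) < (n : ℝ) + (2 + Fintype.card R) := by positivity
  simp only [v, walkStep, PiLp.sub_apply, PiLp.smul_apply, smul_eq_mul]
  rw [Finset.sum_Icc_succ_top (by omega : 1 ≤ n + 1 + 1)]
  push_cast
  generalize ∑ k ∈ Finset.Icc 1 (n + 1), W.V k ω r = s
  field_simp
  ring

theorem limitSet_eq (ω : Ω) :
    W.limitSet ω = {x | MapClusterPt x atTop fun n => W.v (n + 1) ω} := by
  ext x
  constructor
  · rintro ⟨φ, hφ, hx⟩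
    refine MapClusterPt.of_comp ((tendsto_sub_atTop_nat 1).comp hφ) (Tendsto.mapClusterPt ?_)
    refine hx.congr' ?_
    filter_upwards [hφ.eventually_ge_atTop 1] with k hk
    simp [Nat.sub_add_cancel hk]
  · intro hx
    obtain ⟨φ, hφ, hx⟩ := MapClusterPt.tendsto_subseq hx
    exact ⟨fun k => φ k + 1, (tendsto_add_atTop_nat 1).comp hφ.tendsto_atTop, hx⟩

theorem measurableSet_E_eq {n : ℕ} (hn : 1 ≤ n) (e : OrientedEdge ℰ) :
    MeasurableSet[ℱ n] {ω | W.E n ω = e} := by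
  have h : {ω | W.E n ω = e} = {ω | W.X (n - 1) ω = e.1.1} ∩ {ω | W.X n ω = e.1.2} := by
    ext ω
    have h1 : W.E n ω = e ↔ (W.E n ω).1 = e.1 := Subtype.ext_iff
    simp [h1, W.E_eq n hn, Prod.ext_iff]
  rw [h]
  exact (ℱ.mono (Nat.sub_le n 1) _ (W.X_adapted _ _)).inter (W.X_adapted _ _)

theorem measurable_v (n : ℕ) : Measurable[ℱ n] (W.v n) := by
  have h : Measurable[ℱ n] fun ω => (W.v n ω).ofLp := by
    refine @measurable_pi_lambda _ _ _ (ℱ n) _ _ fun r => ?_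
    refine Measurable.div_const (Measurable.const_add (Finset.measurable_fun_sum _
      fun k hk => ?_) _) _
    exact (W.V_adapted k r).mono (ℱ.mono (Finset.mem_Icc.1 hk).2) le_rfl
  exact (WithLp.measurable_toLp 2 (R → ℝ)).comp h

theorem measurable_transition {n : ℕ} (hn : 1 ≤ n) (e : OrientedEdge ℰ) :
    Measurable[ℱ n] fun ω => W.P n ω (W.E n ω) e := by
  have h : (fun ω => W.P n ω (W.E n ω) e) =
      fun ω => ∑ e', {ω | W.E n ω = e'}.indicator (fun ω => W.P n ω e' e) ω := by
    funext ω
    rw [Finset.sum_eq_single (W.E n ω)] <;> simp +contextual [Set.indicator, eq_comm]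
  rw [h]
  exact Finset.measurable_fun_sum _ fun e' _ =>
    (W.P_adapted n e' e).indicator (W.measurableSet_E_eq hn e')

/-- The martingale increment `U (E (n + 1)) - 𝔼[U (E (n + 1)) | ℱ n]`, for a function `U` of edges
that depends on `v n`. -/
noncomputable def increment (U : OrientedEdge ℰ → EuclideanSpace ℝ R → ℝ) (n : ℕ) (ω : Ω) : ℝ :=
  ∑ e, U e (W.v n ω) *
    ({ω | W.E (n + 1) ω = e}.indicator (fun _ => (1 : ℝ)) ω - W.P n ω (W.E n ω) e)

theorem increment_eq (U : OrientedEdge ℰ → EuclideanSpace ℝ R → ℝ) (n : ℕ) (ω : Ω) :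
    W.increment U n ω = U (W.E (n + 1) ω) (W.v n ω) -
      ∑ e, W.P n ω (W.E n ω) e * U e (W.v n ω) := by
  simp only [increment, mul_sub, Finset.sum_sub_distrib]
  congr 1
  · rw [Finset.sum_eq_single (W.E (n + 1) ω)] <;> simp +contextual [Set.indicator, eq_comm]
  · exact Finset.sum_congr rfl fun e _ => mul_comm _ _

theorem transition_mem_Icc (n : ℕ) (ω : Ω) (e e' : OrientedEdge ℰ) :
    W.P n ω e e' ∈ Set.Icc (0 : ℝ) 1 :=
  ⟨(W.P_markov n ω e).1 e', by
    rw [← (W.P_markov n ω e).2]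
    exact Finset.single_le_sum (fun i _ => (W.P_markov n ω e).1 i) (Finset.mem_univ e')⟩

theorem abs_indicator_sub_le_one (n : ℕ) (ω : Ω) (e : OrientedEdge ℰ) :
    |{ω | W.E (n + 1) ω = e}.indicator (fun _ => (1 : ℝ)) ω - W.P n ω (W.E n ω) e| ≤ 1 := by
  have h := W.transition_mem_Icc n ω (W.E n ω) e
  rw [Set.mem_Icc] at h
  by_cases he : ω ∈ {ω | W.E (n + 1) ω = e}
  · rw [Set.indicator_of_mem he, abs_le]
    constructor <;> linarith
  · rw [Set.indicator_of_notMem he, abs_le]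
    constructor <;> linarith

theorem abs_increment_le {U : OrientedEdge ℰ → EuclideanSpace ℝ R → ℝ} {C : ℝ}
    (hU : ∀ e x, |U e x| ≤ C) (n : ℕ) (ω : Ω) :
    |W.increment U n ω| ≤ ∑ _e : OrientedEdge ℰ, C := by
  refine (Finset.abs_sum_le_sum_abs _ _).trans (Finset.sum_le_sum fun e _ => ?_)
  rw [abs_mul]
  have h1 := hU e (W.v n ω)
  have h2 := W.abs_indicator_sub_le_one n ω e
  nlinarith [abs_nonneg (U e (W.v n ω))]

theorem measurable_increment {U : OrientedEdge ℰ → EuclideanSpace ℝ R → ℝ}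
    (hU : ∀ e, Measurable (U e)) {n : ℕ} (hn : 1 ≤ n) :
    Measurable[ℱ (n + 1)] (W.increment U n) := by
  have hle := ℱ.mono n.le_succ
  refine Finset.measurable_fun_sum _ fun e _ => Measurable.mul ?_ (Measurable.sub ?_ ?_)
  · exact (hU e).comp ((W.measurable_v n).mono hle le_rfl)
  · exact measurable_const.indicator (W.measurableSet_E_eq (by omega) e)
  · exact (W.measurable_transition hn e).mono hle le_rfl

/-- Each coefficient `U e (v n)` is known at time `n` and factors out; what remains is the
conditional law of `E (n + 1)` minus itself. -/
theorem condExp_increment [IsProbabilityMeasure ℙ] {U : OrientedEdge ℰ → EuclideanSpace ℝ R → ℝ}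
    {C : ℝ} (hU : ∀ e, Measurable (U e)) (hC : ∀ e x, |U e x| ≤ C) {n : ℕ} (hn : 1 ≤ n) :
    ℙ[W.increment U n | ℱ n] =ᵐ[ℙ] 0 := by
  let I : OrientedEdge ℰ → Ω → ℝ := fun e => {ω | W.E (n + 1) ω = e}.indicator fun _ => 1
  let p : OrientedEdge ℰ → Ω → ℝ := fun e ω => W.P n ω (W.E n ω) e
  let u : OrientedEdge ℰ → Ω → ℝ := fun e ω => U e (W.v n ω)
  have hI : ∀ e, Integrable (I e) ℙ := fun e =>
    (integrable_const 1).indicator (ℱ.le _ _ (W.measurableSet_E_eq (by omega) e))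
  have hp : ∀ e, Integrable (p e) ℙ := fun e =>
    Integrable.of_bound ((W.measurable_transition hn e).mono (ℱ.le n) le_rfl).aestronglyMeasurable 1
      (Eventually.of_forall fun ω => by
        have h := W.transition_mem_Icc n ω (W.E n ω) e
        rw [Real.norm_of_nonneg h.1]
        exact h.2)
  have hum : ∀ e, StronglyMeasurable[ℱ n] (u e) := fun e =>
    ((hU e).comp (W.measurable_v n)).stronglyMeasurable
  have hint : ∀ e, Integrable (u e * (I e - p e)) ℙ := fun e =>
    ((hI e).sub (hp e)).bdd_mul ((hum e).mono (ℱ.le n)).aestronglyMeasurable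
      (Eventually.of_forall fun ω => hC e _)
  have hzero : ∀ e, ℙ[u e * (I e - p e) | ℱ n] =ᵐ[ℙ] 0 := fun e => by
    have h1 := condExp_mul_of_stronglyMeasurable_left (hum e) (hint e) ((hI e).sub (hp e))
    have h2 := condExp_sub (hI e) (hp e) (ℱ n)
    have h3 := condExp_of_stronglyMeasurable (ℱ.le n)
      (W.measurable_transition hn e).stronglyMeasurable (hp e)
    filter_upwards [h1, h2, W.condLaw n hn e] with ω h1 h2 h4
    rw [h1, Pi.mul_apply, h2, Pi.sub_apply, h3]
    have h5 : (ℙ[I e | ℱ n]) ω = p e ω := h4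
    rw [h5]
    simp [p]
  have hsum : W.increment U n = ∑ e, u e * (I e - p e) := by
    funext ω
    simp [increment, u, I, p, Finset.sum_apply]
  rw [hsum]
  refine (condExp_finsetSum (fun e _ => hint e) (ℱ n)).trans ?_
  filter_upwards [ae_all_iff.2 hzero] with ω hω
  simp [Finset.sum_apply, hω]

theorem ae_negligibleNoise_increment [IsProbabilityMeasure ℙ]
    {U : OrientedEdge ℰ → EuclideanSpace ℝ R → ℝ} {C : ℝ} (hU : ∀ e, Measurable (U e))
    (hC : ∀ e x, |U e x| ≤ C) :
    ∀ᵐ ω ∂ℙ, NegligibleNoise (walkStep R) fun n => W.increment U (n + 1) ω := by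
  let 𝒢 : Filtration ℕ mΩ :=
    ⟨fun n => ℱ (n + 1), fun _ _ h => ℱ.mono (Nat.succ_le_succ h), fun n => ℱ.le (n + 1)⟩
  filter_upwards [ae_tendsto_sum_martingale_increments (𝒢 := 𝒢)
    (D := fun n => W.increment U (n + 1)) (fun n => W.measurable_increment hU (by omega))
    (fun n => W.abs_increment_le hC (n + 1)) (fun n => W.condExp_increment hU hC (by omega))
    (summable_walkStep_sq R)] with ω ⟨l, hl⟩
  exact negligibleNoise_of_tendsto_sum (walkStep_nonneg R) hl

end ReinforcedWalk

/-! ### Decomposition of the noise through the Poisson equation. -/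

namespace ReinforcedWalk

variable {𝒳 : Type*} [Finite 𝒳] {ℰ : Set (Sym2 𝒳)} {R : Type*} [Fintype R] {Ω : Type*}
  {mΩ : MeasurableSpace Ω} {ℙ : Measure Ω} {ℱ : Filtration ℕ mΩ} (W : ReinforcedWalk ℰ R ℙ ℱ)

theorem tendsto_v_succ_sub {ω : Ω} (hv : ∀ n, (W.v (n + 1) ω).ofLp ∈ stdSimplex ℝ R) :
    Tendsto (fun n => W.v (n + 2) ω - W.v (n + 1) ω) atTop (𝓝 0) := by
  have hlim : Tendsto (fun n => walkStep R n * 2) atTop (𝓝 0) := by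
    simpa using (tendsto_walkStep R).mul_const 2
  refine squeeze_zero_norm (fun n => ?_) hlim
  rw [v_succ_sub, norm_smul, Real.norm_of_nonneg (walkStep_nonneg R n)]
  refine mul_le_mul_of_nonneg_left ((norm_sub_le _ _).trans ?_) (walkStep_nonneg R n)
  linarith [norm_le_one_of_mem_stdSimplex (W.V_prob (n + 2) ω),
    norm_le_one_of_mem_stdSimplex (hv n)]

theorem tendsto_continuousOn_sub {S : Set (EuclideanSpace ℝ R)} (hS : IsCompact S)
    {f : EuclideanSpace ℝ R → ℝ} (hf : ContinuousOn f S) {ω : Ω} (hvS : ∀ n, W.v (n + 1) ω ∈ S)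
    (hv : ∀ n, (W.v (n + 1) ω).ofLp ∈ stdSimplex ℝ R) :
    Tendsto (fun n => f (W.v (n + 2) ω) - f (W.v (n + 1) ω)) atTop (𝓝 0) := by
  rw [Metric.tendsto_nhds]
  intro ε hε
  obtain ⟨δ, hδ, h⟩ := Metric.uniformContinuousOn_iff.1
    (hS.uniformContinuousOn_of_continuous hf) ε hε
  filter_upwards [Metric.tendsto_nhds.1 (W.tendsto_v_succ_sub hv) δ hδ] with n hn
  rw [dist_zero_right] at hn
  have := h _ (hvS (n + 1)) _ (hvS n) (by rwa [dist_eq_norm])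
  rwa [dist_zero_right, ← dist_eq_norm]

variable {V : Matrix (OrientedEdge ℰ) R ℝ} {S : Set (EuclideanSpace ℝ R)}
  {P : EuclideanSpace ℝ R → Matrix (OrientedEdge ℰ) (OrientedEdge ℰ) ℝ}
  {piV : EuclideanSpace ℝ R → EuclideanSpace ℝ R}

/-- Almost surely, the coordinate `r` of the difference between the reinforcement and its mean under
the invariant measure is a negligible noise. -/
theorem ae_negligibleNoise_coord [IsProbabilityMeasure ℙ] (h1 : Hyp1 W V S P) (h2 : Hyp2 S P)
    (h3 : Hyp3 V S P piV) (r : R) :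
    ∀ᵐ ω ∂ℙ, NegligibleNoise (walkStep R)
      fun n => (W.V (n + 2) ω - piV (W.v (n + 1) ω)) r := by
  classical
  have : Nonempty Ω := nonempty_of_isProbabilityMeasure ℙ
  have : Nonempty (OrientedEdge ℰ) := ⟨W.E 0 (Classical.arbitrary Ω)⟩
  choose q hqc hq using h3.QV_extends
  have hqr : ∀ e, ContinuousOn (fun x => q e x r) S := fun e =>
    (continuous_apply r).comp_continuousOn (hqc e)
  let Φ : OrientedEdge ℰ → EuclideanSpace ℝ R → ℝ := fun e x => ∑ e', P x e e' * q e' x r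
  have hΦ : ∀ e, ContinuousOn (Φ e) S := fun e => continuousOn_finsetSum _ fun e' _ =>
    ((continuous_apply_apply e e').comp_continuousOn h1.P_continuous).mul (hqr e')
  have hbound : ∀ f : OrientedEdge ℰ → EuclideanSpace ℝ R → ℝ, (∀ e, ContinuousOn (f e) S) →
      ∃ C, ∀ e, ∀ x ∈ S, |f e x| ≤ C := fun f hf => by
    choose C hC using fun e => h1.compact.exists_bound_of_continuousOn (hf e)
    exact ⟨∑ e, |C e|, fun e x hx => (hC e x hx).trans ((le_abs_self _).trans
      (Finset.single_le_sum (f := fun e => |C e|) (fun _ _ => abs_nonneg _) (Finset.mem_univ e)))⟩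
  obtain ⟨C, hC⟩ := hbound (fun e x => q e x r) hqr
  obtain ⟨C', hC'⟩ := hbound Φ hΦ
  -- Cutting off outside `S` makes the coefficients globally measurable and bounded, without
  -- changing them along the walk.
  let U : OrientedEdge ℰ → EuclideanSpace ℝ R → ℝ := fun e => S.indicator fun x => q e x r
  have hUm : ∀ e, Measurable (U e) := fun e => by
    have := (hqr e).measurable_piecewise (g := 0) continuousOn_const
      h1.compact.measurableSet
    rwa [Set.piecewise_eq_indicator] at this
  have hUb : ∀ e x, |U e x| ≤ |C| := fun e x => by
    by_cases hx : x ∈ S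
    · simpa [U, hx] using (hC e x hx).trans (le_abs_self C)
    · simp [U, hx]
  filter_upwards [W.ae_negligibleNoise_increment hUm hUb,
    ae_all_iff.2 fun n => h1.V_eq (n + 2) (by omega),
    ae_all_iff.2 fun n => h1.v_mem (n + 1) (by omega),
    ae_all_iff.2 fun n => h1.P_eq (n + 1) (by omega)] with ω hD hV hv hP
  have hvS : ∀ n, W.v (n + 1) ω ∈ S := fun n => mem_of_mem_nhdsWithin (hv n).1 (hv n).2
  have htel := negligibleNoise_telescoping (a := fun n => Φ (W.E (n + 1) ω) (W.v (n + 1) ω))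
    (walkStep_nonneg R) (antitone_walkStep R) (tendsto_walkStep R) fun n => hC' _ _ (hvS n)
  have hrem : Tendsto (fun n => Φ (W.E (n + 2) ω) (W.v (n + 2) ω) -
      Φ (W.E (n + 2) ω) (W.v (n + 1) ω)) atTop (𝓝 0) := by
    -- The edge varies with `n`, so the difference is bounded by the sum over all edges.
    have hlim : Tendsto (fun n => ∑ e, |Φ e (W.v (n + 2) ω) - Φ e (W.v (n + 1) ω)|) atTop
        (𝓝 0) := by
      simpa using tendsto_finsetSum Finset.univ fun e _ => (W.tendsto_continuousOn_sub h1.compact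
        (hΦ e) hvS fun n => h1.subset_simplex _ (hvS n)).abs
    refine squeeze_zero_norm (fun n => ?_) hlim
    exact Finset.single_le_sum (f := fun e => |Φ e (W.v (n + 2) ω) - Φ e (W.v (n + 1) ω)|)
      (fun _ _ => abs_nonneg _) (Finset.mem_univ (W.E (n + 2) ω))
  -- With `Φ = P q`, the noise `q (E (n+2), v (n+1)) - Φ (E (n+2), v (n+1))` is the sum of a
  -- martingale increment, which subtracts `Φ (E (n+1), v (n+1))`, of the telescoping term from
  -- there to `Φ (E (n+2), v (n+2))`, and of the change of `Φ` when only `v` moves.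
  refine ((hD.add htel).add (negligibleNoise_of_tendsto_zero (walkStep_nonneg R) hrem)).congr
    (Eventually.of_forall fun n => ?_)
  have hpois := sub_vecMul_invProb (h1.P_markov _ (hvS n)) (h2.indecomposable _ (hv n)) V
    (W.E (n + 2) ω) r
  have hqv : ∀ e, (pseudoInverse (P (W.v (n + 1) ω)) * V) e r = q e (W.v (n + 1) ω) r := fun e => by
    rw [hq e _ (hv n)]
  simp only [hqv] at hpois
  have hUq : ∀ e, U e (W.v (n + 1) ω) = q e (W.v (n + 1) ω) r := fun e =>
    Set.indicator_of_mem (hvS n) _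
  have hVr : W.V (n + 2) ω r = V (W.E (n + 2) ω) r := congrFun (hV n) r
  have hpr : piV (W.v (n + 1) ω) r = Matrix.vecMul (invProb (P (W.v (n + 1) ω))) V r :=
    congrFun (h3.piV_eq _ (hv n)) r
  rw [W.increment_eq, PiLp.sub_apply, hVr, hpr, hpois, hP n]
  simp only [hUq]
  simp only [Φ]
  ring

/-- Almost surely, the sequence `n ↦ v (n + 1)` is an approximation scheme for the field `F`. -/
theorem ae_approxScheme [IsProbabilityMeasure ℙ] (h1 : Hyp1 W V S P) (h2 : Hyp2 S P)
    (h3 : Hyp3 V S P piV) :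
    ∀ᵐ ω ∂ℙ, ApproxScheme S (field piV) (walkStep R) (fun n => W.v (n + 1) ω)
      (fun n => W.V (n + 2) ω - piV (W.v (n + 1) ω)) := by
  filter_upwards [ae_all_iff.2 (W.ae_negligibleNoise_coord h1 h2 h3),
    ae_all_iff.2 fun n => h1.v_mem (n + 1) (by omega)] with ω hnoise hv
  have hvS : ∀ n, W.v (n + 1) ω ∈ S := fun n => mem_of_mem_nhdsWithin (hv n).1 (hv n).2
  have hstep : ∀ n, field piV (W.v (n + 1) ω) + (W.V (n + 2) ω - piV (W.v (n + 1) ω)) =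
      W.V (n + 2) ω - W.v (n + 1) ω := fun n => by
    unfold field
    abel
  refine ⟨hvS, walkStep_nonneg R, tendsto_walkStep R, tendsto_sum_walkStep R, fun n => ?_,
    ⟨1 + 1, fun n => ?_⟩, NegligibleNoise.of_coord (walkStep_nonneg R) hnoise⟩
  · rw [hstep]
    exact W.v_succ_sub n ω
  · rw [hstep]
    exact (norm_sub_le _ _).trans (add_le_add (norm_le_one_of_mem_stdSimplex (W.V_prob _ ω))
      (norm_le_one_of_mem_stdSimplex (h1.subset_simplex _ (hvS n))))

end ReinforcedWalk

theorem equilibria_eq {R : Type*} (S : Set (EuclideanSpace ℝ R))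
    (piV : EuclideanSpace ℝ R → EuclideanSpace ℝ R) :
    equilibria S piV = {p ∈ S | field piV p = 0} := by
  ext p
  simp only [equilibria, field, Set.mem_ofPred_eq, neg_add_eq_zero]

end RRW

/-! ### The convergence theorem. -/

theorem theorem3 {𝒳 : Type*} [Finite 𝒳] (ℰ : Set (Sym2 𝒳)) {R : Type*} [Fintype R]
    {Ω : Type*} {mΩ : MeasurableSpace Ω} (ℙ : Measure Ω) [IsProbabilityMeasure ℙ]
    (ℱ : Filtration ℕ mΩ) (W : RRW.ReinforcedWalk ℰ R ℙ ℱ)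
    (V : Matrix (RRW.OrientedEdge ℰ) R ℝ) (S : Set (EuclideanSpace ℝ R))
    (P : EuclideanSpace ℝ R → Matrix (RRW.OrientedEdge ℰ) (RRW.OrientedEdge ℰ) ℝ)
    (piV : EuclideanSpace ℝ R → EuclideanSpace ℝ R)
    (h1 : RRW.Hyp1 W V S P) (h2 : RRW.Hyp2 S P) (h3 : RRW.Hyp3 V S P piV)
    (H : EuclideanSpace ℝ R → ℝ) (hH : RRW.IsStrictLyapunov S piV H) :
    (interior (H '' RRW.equilibria S piV) = ∅ →
      ∀ᵐ ω ∂ℙ, W.limitSet ω ⊆ RRW.equilibria S piV ∧ IsConnected (W.limitSet ω) ∧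
        ∀ x ∈ W.limitSet ω, ∀ y ∈ W.limitSet ω, H x = H y) ∧
    ((RRW.equilibria S piV).Finite →
      ∀ᵐ ω ∂ℙ, ∃ v ∈ RRW.equilibria S piV, Tendsto (fun n => W.v n ω) atTop (𝓝 v)) := by
  have hF : ContinuousOn (RRW.field piV) S := by
    obtain ⟨K, hK⟩ := h3.piV_lipschitz
    exact continuousOn_id.neg.add hK.continuousOn
  have hH' : ∀ p ∈ S, ∃ g, HasGradientWithinAt H g S p ∧
      (RRW.field piV p ≠ 0 → 0 < inner ℝ g (RRW.field piV p)) := fun p hp => by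
    obtain ⟨g, hg, hpos⟩ := hH p hp
    exact ⟨g, hg, fun h0 => hpos fun hmem => h0 (RRW.equilibria_eq S piV ▸ hmem).2⟩
  have hscheme := W.ae_approxScheme h1 h2 h3
  have hmain : interior (H '' RRW.equilibria S piV) = ∅ →
      ∀ᵐ ω ∂ℙ, W.limitSet ω ⊆ RRW.equilibria S piV ∧ IsConnected (W.limitSet ω) ∧
        ∀ x ∈ W.limitSet ω, ∀ y ∈ W.limitSet ω, H x = H y := by
    intro hint
    filter_upwards [hscheme] with ω hω
    rw [RRW.equilibria_eq] at hint ⊢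
    obtain ⟨l, hl⟩ := hω.exists_tendsto_lyapunov h1.compact hF hH' hint
    have hcl := fun x (hx : x ∈ W.limitSet ω) =>
      hω.eq_zero_of_mapClusterPt h1.compact hF hH' hl (W.limitSet_eq ω ▸ hx)
    refine ⟨fun x hx => ⟨(hcl x hx).1, (hcl x hx).2.2⟩, ?_, fun x hx y hy => ?_⟩
    · rw [W.limitSet_eq]
      exact RRW.isConnected_clusterPts h1.compact hω.mem hω.tendsto_succ_sub
    · rw [(hcl x hx).2.1, (hcl y hy).2.1]
  refine ⟨hmain, fun hfin => ?_⟩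
  have hint := interior_eq_empty_iff_dense_compl.2 ((hfin.image H).countable.dense_compl ℝ)
  filter_upwards [hscheme, hmain hint] with ω hω hL
  obtain ⟨hsub, hconn, -⟩ := hL
  -- A connected subset of a finite set has at most one point, and a sequence in a compact set with
  -- a single cluster point converges.
  have hss : (W.limitSet ω).Subsingleton :=
    hfin.countable.isTotallyDisconnected _ hsub hconn.isPreconnected
  obtain ⟨p, hp⟩ := hconn.nonempty
  refine ⟨p, hsub hp, (tendsto_add_atTop_iff_nat 1).1 ?_⟩
  refine h1.compact.tendsto_nhds_of_unique_mapClusterPt (Eventually.of_forall hω.mem)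
    fun x _ hx => hss ?_ hp
  rw [W.limitSet_eq]
  exact hx
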